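/- Let $\Sigma=\{0,1\}$ and let $\Sigma^*$ be the set of finite non-empty strings over $\Sigma$. A promise problem is a function $\phi$ assigning to each $x\in\Sigma^*$ a non-empty subset $\phi(x)\subseteq\Sigma$ (the valid answers). For promise problems write $\phi_1\propto\phi_2$ if there is a function $\mu:\Sigma^*\to\Sigma^*$, computed by a Turing machine in time polynomial in $|x|$, such that $\phi_1(x)\supseteq\phi_2(\mu(x))$ for all $x\in\Sigma^*$; the strong closure of $\phi$ is $[\phi]=\{\psi\mid\psi\propto\phi\}$. Let $n\ge 1$. The inputs of the following problems are the strings that encode a function $f:\Sigma^{m_1}\times\cdots\times\Sigma^{m_n}\to\Sigma$ with $m_1\ge1$, given by the numbers $m_1,\dots,m_n$ (in unary) and a Boolean expression in $\land,\lor,\lnot$ and the $m_1+\cdots+m_n$ variables; on strings that are not such an encoding the value of each problem is $\Sigma$. For $x\in\Sigma^{m_1}$ let $f_x$ be the function of the remaining $n-1$ arguments obtained by fixing the first argument to be $x$, and let $x_1$ be the first bit of $x$. Put $\mathrm{SAT}_0(f)=\overline{\mathrm{SAT}}_0(f)=f$ and, for $n\ge1$, $\mathrm{SAT}_n(f)=1\iff\exists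 x\;\overline{\mathrm{SAT}}_{n-1}(f_x)=1$ and $\overline{\mathrm{SAT}}_n(f)=1\iff\forall x\;\mathrm{SAT}_{n-1}(f_x)=1$. Define * $\mathrm{USAT}_n(f)=\{\mathrm{SAT}_n(f)\}$ if at most one $x$ satisfies $\overline{\mathrm{SAT}}_{n-1}(f_x)=1$, and $\Sigma$ otherwise; * $\overline{\mathrm{USAT}}_n(f)=\{\overline{\mathrm{SAT}}_n(f)\}$ if at most one $x$ satisfies $\mathrm{SAT}_{n-1}(f_x)=0$, and $\Sigma$ otherwise; * $\mathrm{UVAL}_n(f)=\{x_1\mid\overline{\mathrm{SAT}}_{n-1}(f_x)=1\}$ if exactly one $x$ satisfies $\overline{\mathrm{SAT}}_{n-1}(f_x)=1$, and $\Sigma$ otherwise. Then, for every $n\ge1$, $$[\mathrm{UVAL}_n]=[\mathrm{USAT}_n]\cap[\overline{\mathrm{USAT}}_n].$$ (For $n=1$, $[\mathrm{USAT}_1]$ is promise-$\mathrm{UP}$ and $[\overline{\mathrm{USAT}}_1]$ is promise-$\mathrm{coUP}$, so this says that $\mathrm{UVAL}_1$ is complete for their intersection.) -/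

import Mathlib

namespace PromiseHierarchy

/-! ### Promise problems and strong reduction -/

/-- Finite non-empty strings over the alphabet `{0, 1}`. -/
abbrev Str : Type := {w : List Bool // w ≠ []}

/-- The non-empty subsets of the alphabet `{0, 1}`. -/
abbrev Answer : Type := {s : Set Bool // s.Nonempty}

/-- The whole alphabet: both answers are valid. -/
def anyAnswer : Answer := ⟨Set.univ, Set.univ_nonempty⟩

/-- The answer set `s` if the promise `P` holds, and the whole alphabet otherwise. -/
noncomputable def promise (P : Prop) (s : Set Bool) (hs : P → s.Nonempty) : Answer :=
  open Classical in if h : P then ⟨s, hs h⟩ else anyAnswer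

/-- A promise problem assigns to every string the non-empty set of its valid answers. -/
abbrev PromiseProblem : Type := Str → Answer

/-- `μ` is computed by a (multi-tape) Turing machine in time polynomial in the input length. -/
def PolyTimeComputable (μ : Str → Str) : Prop :=
  Nonempty (Turing.TM2ComputableInPolyTime
    (Subtype.val : Str → List Bool) (Subtype.val : Str → List Bool) μ)

/-- Strong (many-one) reduction between promise problems. -/
def StrongReduces (φ₁ φ₂ : PromiseProblem) : Prop :=
  ∃ μ : Str → Str, PolyTimeComputable μ ∧ ∀ x : Str, (φ₂ (μ x)).1 ⊆ (φ₁ x).1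

/-- The strong closure `[φ]`: all promise problems that strongly reduce to `φ`. -/
def strongClosure (φ : PromiseProblem) : Set PromiseProblem :=
  {ψ | StrongReduces ψ φ}

/-! ### Boolean functions in several blocks of variables -/

/-- Functions `Σ^{m 0} × ⋯ × Σ^{m (n-1)} → Σ`, where `Σ = {0, 1}`. -/
abbrev BoolFun {n : ℕ} (m : Fin n → ℕ) : Type :=
  ((i : Fin n) → (Fin (m i) → Bool)) → Bool

/-- The function of the remaining blocks obtained by fixing the first block to be `x`. -/
def BoolFun.fix {n : ℕ} {m : Fin (n + 1) → ℕ} (f : BoolFun m) (x : Fin (m 0) → Bool) :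
    BoolFun (fun i : Fin n => m i.succ) :=
  fun y => f (Fin.cons (α := fun i => Fin (m i) → Bool) x y)

/-- `n` alternating quantifiers over the blocks of `f`, the first one being `∃` if `ex = true`
and `∀` if `ex = false`. -/
def Alternating (ex : Bool) : {n : ℕ} → {m : Fin n → ℕ} → BoolFun m → Prop
  | 0, _, f => f (fun i => i.elim0) = true
  | n + 1, m, f =>
    match ex with
    | true => ∃ x : Fin (m 0) → Bool, Alternating false (n := n) (f.fix x)
    | false => ∀ x : Fin (m 0) → Bool, Alternating true (n := n) (f.fix x)

/-- `SAT f` says that `SAT_n(f) = 1`, where `n` is the number of blocks of `f`. -/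
def SAT {n : ℕ} {m : Fin n → ℕ} (f : BoolFun m) : Prop := Alternating true f

/-- `CoSAT f` says that `co-SAT_n(f) = 1`, where `n` is the number of blocks of `f`. -/
def CoSAT {n : ℕ} {m : Fin n → ℕ} (f : BoolFun m) : Prop := Alternating false f

/-- The truth value of a proposition, as a letter of the alphabet. -/
noncomputable def truth (P : Prop) : Bool := open Classical in decide P

/-! ### Boolean expressions and their encoding -/

/-- Boolean expressions in variables from `V`. -/
inductive BoolExpr (V : Type) : Type
  | var (v : V) : BoolExpr V
  | not (e : BoolExpr V) : BoolExpr V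
  | and (e₁ e₂ : BoolExpr V) : BoolExpr V
  | or (e₁ e₂ : BoolExpr V) : BoolExpr V

/-- The value of an expression under an assignment. -/
def BoolExpr.eval {V : Type} (ρ : V → Bool) : BoolExpr V → Bool
  | .var v => ρ v
  | .not e => !(e.eval ρ)
  | .and e₁ e₂ => e₁.eval ρ && e₂.eval ρ
  | .or e₁ e₂ => e₁.eval ρ || e₂.eval ρ

/-- The self-delimiting unary code `1^k 0` of `k`. -/
def unary (k : ℕ) : List Bool := List.replicate k true ++ [false]

/-- The code of an expression whose variables are the pairs (block `i`, position `j`):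
prefix notation with two-letter tags, a variable being followed by `1^i 0 1^j 0`. -/
def BoolExpr.code {n : ℕ} {m : Fin n → ℕ} : BoolExpr ((i : Fin n) × Fin (m i)) → List Bool
  | .var v => false :: false :: (unary v.1 ++ unary v.2)
  | .not e => false :: true :: e.code
  | .and e₁ e₂ => true :: false :: (e₁.code ++ e₂.code)
  | .or e₁ e₂ => true :: true :: (e₁.code ++ e₂.code)

/-- An input of a problem of level `n + 1`: the numbers `m 0, …, m n` of variables in the
`n + 1` blocks, the first of which is non-empty, and an expression in these variables. -/
structure Input (n : ℕ) : Type where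
  m : Fin (n + 1) → ℕ
  pos : 0 < m 0
  expr : BoolExpr ((i : Fin (n + 1)) × Fin (m i))

/-- The code of the numbers of variables. -/
def header {n : ℕ} (m : Fin n → ℕ) : List Bool := (List.ofFn m).flatMap unary

namespace Input

variable {n : ℕ}

/-- The function `Σ^{m 0} × ⋯ × Σ^{m n} → Σ` that the input describes. -/
def fn (F : Input n) : BoolFun F.m := fun x => F.expr.eval (fun v => x v.1 v.2)

theorem code_ne_nil (F : Input n) : header F.m ++ F.expr.code ≠ [] := by
  simp [header, unary, List.ofFn_succ]

/-- The string that encodes the input. -/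
def code (F : Input n) : Str := ⟨header F.m ++ F.expr.code, F.code_ne_nil⟩

/-- `{SAT(f)}` on the promise that at most one `x` has `co-SAT(f_x) = 1`. -/
noncomputable def usat (F : Input n) : Answer :=
  promise ({x | CoSAT (F.fn.fix x)}.ncard ≤ 1) {truth (SAT F.fn)}
    (fun _ => Set.singleton_nonempty _)

/-- `{co-SAT(f)}` on the promise that at most one `x` has `SAT(f_x) = 0`. -/
noncomputable def coUsat (F : Input n) : Answer :=
  promise ({x | ¬ SAT (F.fn.fix x)}.ncard ≤ 1) {truth (CoSAT F.fn)}
    (fun _ => Set.singleton_nonempty _)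

/-- The first bits of all `x` with `co-SAT(f_x) = 1`, on the promise that there is exactly
one such `x`. -/
noncomputable def uval (F : Input n) : Answer :=
  promise (∃! x, CoSAT (F.fn.fix x))
    {b | ∃ x : Fin (F.m 0) → Bool, CoSAT (F.fn.fix x) ∧ x ⟨0, F.pos⟩ = b}
    (fun h => h.exists.elim fun x hx => ⟨_, x, hx, rfl⟩)

end Input

/-! The encoding is injective, so that an encoded input can be recovered from its code. -/

theorem unary_append_inj {a b : ℕ} {s t : List Bool} (h : unary a ++ s = unary b ++ t) :
    a = b ∧ s = t := by
  induction a generalizing b with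
  | zero => cases b <;> simp_all [unary, List.replicate_succ]
  | succ a ih =>
    cases b with
    | zero => simp [unary, List.replicate_succ] at h
    | succ b =>
      have h' : unary a ++ s = unary b ++ t := by
        simpa [unary, List.replicate_succ] using h
      obtain ⟨h₁, h₂⟩ := ih h'
      exact ⟨by rw [h₁], h₂⟩

theorem header_append_inj {n : ℕ} {m m' : Fin n → ℕ} {s t : List Bool}
    (h : header m ++ s = header m' ++ t) : m = m' ∧ s = t := by
  induction n with
  | zero => exact ⟨Subsingleton.elim _ _, by simpa [header] using h⟩
  | succ n ih =>
    simp only [header, List.ofFn_succ, List.flatMap_cons, List.append_assoc] at h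
    obtain ⟨h₀, h₁⟩ := unary_append_inj h
    obtain ⟨h₂, h₃⟩ := ih h₁
    refine ⟨funext fun i => ?_, h₃⟩
    refine Fin.cases h₀ (fun j => ?_) i
    exact congrFun h₂ j

theorem BoolExpr.code_append_inj {n : ℕ} {m : Fin n → ℕ}
    {e e' : BoolExpr ((i : Fin n) × Fin (m i))} {s t : List Bool}
    (h : e.code ++ s = e'.code ++ t) : e = e' ∧ s = t := by
  induction e generalizing e' s t with
  | var v =>
    cases e' with
    | var v' =>
      simp only [code, List.cons_append, List.append_assoc, List.cons.injEq, true_and] at h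
      obtain ⟨h₁, h₂⟩ := unary_append_inj h
      obtain ⟨h₃, h₄⟩ := unary_append_inj h₂
      obtain ⟨i, j⟩ := v
      obtain ⟨i', j'⟩ := v'
      obtain rfl : i = i' := Fin.ext h₁
      obtain rfl : j = j' := Fin.ext h₃
      exact ⟨rfl, h₄⟩
    | _ => simp [code] at h
  | not e ih =>
    cases e' with
    | not e' =>
      simp only [code, List.cons_append, List.cons.injEq, true_and] at h
      obtain ⟨rfl, h₂⟩ := ih h
      exact ⟨rfl, h₂⟩
    | _ => simp [code] at h
  | and e₁ e₂ ih₁ ih₂ =>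
    cases e' with
    | and e₁' e₂' =>
      simp only [code, List.cons_append, List.append_assoc, List.cons.injEq, true_and] at h
      obtain ⟨rfl, h₂⟩ := ih₁ h
      obtain ⟨rfl, h₃⟩ := ih₂ h₂
      exact ⟨rfl, h₃⟩
    | _ => simp [code] at h
  | or e₁ e₂ ih₁ ih₂ =>
    cases e' with
    | or e₁' e₂' =>
      simp only [code, List.cons_append, List.append_assoc, List.cons.injEq, true_and] at h
      obtain ⟨rfl, h₂⟩ := ih₁ h
      obtain ⟨rfl, h₃⟩ := ih₂ h₂
      exact ⟨rfl, h₃⟩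
    | _ => simp [code] at h

theorem Input.code_injective (n : ℕ) : Function.Injective (Input.code (n := n)) := by
  rintro ⟨m, hm, e⟩ ⟨m', hm', e'⟩ h
  have h' : header m ++ e.code = header m' ++ e'.code := congrArg Subtype.val h
  obtain ⟨rfl, h₂⟩ := header_append_inj h'
  obtain ⟨rfl, -⟩ := BoolExpr.code_append_inj (s := []) (t := []) (by simpa using h₂)
  rfl

/-! ### The problems of level `n ≥ 1` -/

/-- The promise problem on strings given by a problem on inputs. It is part of the promise that
the string is the code of an input. -/
noncomputable def onCodes {n : ℕ} (A : Input n → Answer) : PromiseProblem :=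
  Function.extend Input.code A (fun _ => anyAnswer)

/-- The promise problem `USAT_n`, for `n ≥ 1`. -/
noncomputable def USAT : ℕ → PromiseProblem
  | 0 => fun _ => anyAnswer
  | n + 1 => onCodes (Input.usat (n := n))

/-- The promise problem `co-USAT_n`, for `n ≥ 1`. -/
noncomputable def CoUSAT : ℕ → PromiseProblem
  | 0 => fun _ => anyAnswer
  | n + 1 => onCodes (Input.coUsat (n := n))

/-- The promise problem `UVAL_n`, for `n ≥ 1`. -/
noncomputable def UVAL : ℕ → PromiseProblem
  | 0 => fun _ => anyAnswer
  | n + 1 => onCodes (Input.uval (n := n))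

end PromiseHierarchy

namespace PromiseHierarchy

/-! ### Alternating quantifiers -/

/-! Call `x` a witness of `f` if `CoSAT (f.fix x)`, and a counterexample if `¬ SAT (f.fix x)`.
Suppose that `ψ` reduces both to `USAT` and to `CoUSAT`, and that the two reductions send a string
to inputs `F` and `G`. Let `Input.combine` have as witnesses the words `1z` for the witnesses `z` of
`F` and `0z` for the counterexamples `z` of `G`. If a promise fails, every answer is valid for `ψ`.
If both promises hold and the two answers agree on a letter, there is exactly one witness and it
begins with that letter; if they disagree, both letters are valid for `ψ`. This is
`Input.uval_combine_subset`.

Conversely, let `f` have exactly one witness `x`. Then `f ∧ x₁` has at most one witness, and `¬(f ∧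
¬x₁)` has at most one counterexample; in both cases the truth value asked for is the first bit of
`x` (`Input.usat_selectOne_subset`, `Input.coUsat_selectZero_subset`).

The words of `F` and `G` have to share one block. In the first block unused variables are pinned to
zero, since otherwise uniqueness would be lost; in later blocks they do no harm, because quantifying
over a surjective image changes nothing (`alternating_comp`).

Most of the work is polynomial time. All three constructions are given the same textual shape, a
`Template` filled from two codes. One machine runs the two given machines and merges their outputs
with a finite transducer and unary counters (`polyTimeComputable_applyStr`). -/

theorem alternating_comp {n : ℕ} {m M : Fin n → ℕ}
    (r : (i : Fin n) → (Fin (M i) → Bool) → (Fin (m i) → Bool))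
    (hr : ∀ i, Function.Surjective (r i)) (ex : Bool) (f : BoolFun m) :
    Alternating (m := M) ex (fun y => f (fun i => r i (y i))) ↔ Alternating ex f := by
  induction n generalizing ex with
  | zero =>
    simp only [Alternating]
    rw [show (fun i : Fin 0 => r i ((fun i => i.elim0 : (i : Fin 0) → Fin (M i) → Bool) i)) =
      fun i => i.elim0 from funext fun i => i.elim0]
  | succ n ih =>
    have key : ∀ x : Fin (M 0) → Bool,
        BoolFun.fix (m := M) (fun y => f (fun i => r i (y i))) x =
          fun y => f.fix (r 0 x) (fun i => r i.succ (y i)) := by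
      intro x
      funext y
      refine congrArg f (funext fun i => ?_)
      refine Fin.cases rfl (fun j => rfl) i
    cases ex
    · simp only [Alternating, key, ih (fun i => r i.succ) (fun i => hr i.succ)]
      -- A quantifier over the domain of a surjection is a quantifier over its codomain.
      exact ((hr 0).forall (p := fun z => Alternating true (f.fix z))).symm
    · simp only [Alternating, key, ih (fun i => r i.succ) (fun i => hr i.succ)]
      exact ((hr 0).exists (p := fun z => Alternating false (f.fix z))).symm

theorem alternating_not {n : ℕ} {m : Fin n → ℕ} (ex : Bool) (f : BoolFun m) :
    Alternating (m := m) ex (fun y => !(f y)) ↔ ¬ Alternating (!ex) f := by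
  induction n generalizing ex with
  | zero => simp [Alternating]
  | succ n ih =>
    have key : ∀ x : Fin (m 0) → Bool,
        BoolFun.fix (m := m) (fun y => !(f y)) x = fun y => !(f.fix x y) := fun x => rfl
    cases ex <;> simp [Alternating, key, ih]

/-- Every block of assignments is non-empty, even one without variables, so all quantifiers can be
dropped. -/
theorem alternating_const {n : ℕ} {m : Fin n → ℕ} (ex c : Bool) :
    Alternating (m := m) ex (fun _ => c) ↔ c = true := by
  induction n generalizing ex with
  | zero => simp [Alternating]
  | succ n ih =>
    have key : ∀ x : Fin (m 0) → Bool,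
        BoolFun.fix (m := m) (fun _ => c) x = fun _ => c := fun x => rfl
    cases ex <;> simp [Alternating, key, ih]

/-! ### Renaming and restricting variables -/

namespace BoolExpr

def rename {V W : Type} (g : V → W) : BoolExpr V → BoolExpr W
  | var v => var (g v)
  | not e => not (e.rename g)
  | and e₁ e₂ => and (e₁.rename g) (e₂.rename g)
  | or e₁ e₂ => or (e₁.rename g) (e₂.rename g)

theorem eval_rename {V W : Type} (g : V → W) (ρ : W → Bool) (e : BoolExpr V) :
    (e.rename g).eval ρ = e.eval (fun v => ρ (g v)) := by
  induction e <;> simp_all [rename, eval]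

/-- The Boolean function in the remaining blocks, after the first block is fixed. -/
def slice {n : ℕ} {m : Fin (n + 1) → ℕ} (e : BoolExpr ((i : Fin (n + 1)) × Fin (m i)))
    (x : Fin (m 0) → Bool) : BoolFun (fun i : Fin n => m i.succ) :=
  fun y => e.eval (fun v => Fin.cons (α := fun i => Fin (m i) → Bool) x y v.1 v.2)

/-- The conjunction of `e` and the negations of the variables `a + 1, …, a + c` of the
first block. -/
def pins {n : ℕ} {m : Fin (n + 1) → ℕ} (e : BoolExpr ((i : Fin (n + 1)) × Fin (m i))) :
    (a c : ℕ) → a + c < m 0 → BoolExpr ((i : Fin (n + 1)) × Fin (m i))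
  | _, 0, _ => e
  | a, c + 1, h => and (not (var ⟨0, ⟨a + 1, by omega⟩⟩)) (e.pins (a + 1) c (by omega))

/-- The pinning conditions concern the first block only. Once `x` is fixed they are a constant
factor, which a case distinction removes from under the remaining quantifiers. -/
theorem slice_pins {n : ℕ} {m : Fin (n + 1) → ℕ}
    (e : BoolExpr ((i : Fin (n + 1)) × Fin (m i))) (a c : ℕ) (h : a + c < m 0)
    (x : Fin (m 0) → Bool) (y : (i : Fin n) → Fin (m i.succ) → Bool) :
    (e.pins a c h).slice x y =
      ((decide (∀ p : Fin (m 0), a < p → p ≤ a + c → x p = false)) && e.slice x y) := by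
  induction c generalizing a with
  | zero =>
    have : ∀ p : Fin (m 0), a < p → p ≤ a + 0 → x p = false := fun p h₁ h₂ => by omega
    simp only [pins, decide_eq_true this, Bool.true_and]
  | succ c ih =>
    have h₁ : (e.pins a (c + 1) h).slice x y =
      (!(x ⟨a + 1, by omega⟩) && (e.pins (a + 1) c (by omega)).slice x y) := rfl
    rw [h₁, ih, ← Bool.and_assoc]
    congr 1
    rw [Bool.eq_iff_iff]
    simp only [Bool.and_eq_true, Bool.not_eq_true', decide_eq_true_eq]
    constructor
    · rintro ⟨h₂, h₃⟩ p hp hp'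
      rcases eq_or_ne (p : ℕ) (a + 1) with h₄ | h₄
      · rw [← h₂]; exact congrArg x (Fin.ext h₄)
      · exact h₃ p (by omega) (by omega)
    · intro h₂
      exact ⟨h₂ _ (by simp) (by simp), fun p hp hp' => h₂ p (by omega) (by omega)⟩

end BoolExpr

/-! ### Placing two inputs in common blocks of variables -/

/-- One new variable is put in front of the first block. -/
def offset {n : ℕ} (i : Fin (n + 1)) : ℕ := if i = 0 then 1 else 0

/-- Moves the variables of the first block one place. -/
def shiftVar {n : ℕ} {m M : Fin (n + 1) → ℕ} (h : ∀ i, m i + offset i ≤ M i)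
    (v : (i : Fin (n + 1)) × Fin (m i)) : (i : Fin (n + 1)) × Fin (M i) :=
  ⟨v.1, ⟨v.2 + offset v.1, by have := h v.1; omega⟩⟩

/-- The assignment in `Σ^M` that consists of the letter `c`, the word `z`, and zeros. -/
def pad {k M : ℕ} (c : Bool) (z : Fin k → Bool) : Fin M → Bool :=
  fun p => if (p : ℕ) = 0 then c else if h : (p : ℕ) - 1 < k then z ⟨p - 1, h⟩ else false

/-- These are the conditions that an expression can test: the tag bit, the trailing zeros, and the
word in between. The hypothesis leaves room for the whole word, so `z` can be recovered from `x`. -/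
theorem eq_pad_iff {k M : ℕ} (h : k + 1 ≤ M) (c : Bool) (z : Fin k → Bool) (x : Fin M → Bool) :
    x = pad c z ↔ x ⟨0, by omega⟩ = c ∧ (∀ p : Fin M, k < p → x p = false) ∧
      (fun j : Fin k => x ⟨j + 1, by omega⟩) = z := by
  constructor
  · rintro rfl
    refine ⟨by simp [pad], fun p hp => ?_, ?_⟩
    · simp only [pad]
      rw [if_neg (by omega), dif_neg (by omega)]
    · funext j
      simp [pad]
  · rintro ⟨h₁, h₂, rfl⟩
    funext p
    simp only [pad]
    split_ifs with h₃ h₄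
    · rw [← h₁]; exact congrArg x (Fin.ext h₃)
    · refine congrArg x (Fin.ext ?_); simp; omega
    · exact h₂ p (by omega)

theorem pad_zero {k M : ℕ} (h : 0 < M) (c : Bool) (z : Fin k → Bool) :
    pad c z (⟨0, h⟩ : Fin M) = c := by
  simp [pad]

namespace Input

variable {n : ℕ}

/-- In the later blocks the renamed expression sees only a truncation of each assignment. Truncation
is surjective, so `alternating_comp` applies. -/
theorem alternating_slice_rename (F : Input n) {M : Fin (n + 1) → ℕ}
    (h : ∀ i, F.m i + offset i ≤ M i) (ex : Bool) (x : Fin (M 0) → Bool) :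
    Alternating ex ((F.expr.rename (shiftVar h)).slice x) ↔
      Alternating ex (F.fn.fix fun j => x ⟨j + 1, by
        have h₀ := h 0; simp only [offset, if_true] at h₀; omega⟩) := by
  have hle : ∀ i : Fin n, F.m i.succ ≤ M i.succ := fun i => (Nat.le_add_right _ _).trans (h i.succ)
  rw [← alternating_comp (fun i (y : Fin (M i.succ) → Bool) j => y (Fin.castLE (hle i) j))]
  · refine iff_of_eq (congrArg _ (funext fun y => ?_))
    simp only [BoolExpr.slice, BoolExpr.eval_rename, BoolFun.fix, fn]
    refine congrArg (fun ρ => F.expr.eval ρ) (funext fun v => ?_)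
    suffices hv : ∀ (i : Fin (n + 1)) (j : Fin (F.m i)),
        Fin.cons (α := fun i => Fin (M i) → Bool) x y (shiftVar h ⟨i, j⟩).1 (shiftVar h ⟨i, j⟩).2 =
          Fin.cons (α := fun i => Fin (F.m i) → Bool) (fun j => x ⟨j + 1, by
            have h₀ := h 0; simp only [offset, if_true] at h₀; omega⟩)
            (fun i j => y i (Fin.castLE (hle i) j)) i j from hv v.1 v.2
    intro i
    refine Fin.cases (fun j => ?_) (fun i j => ?_) i
    · rfl
    · rfl
  · intro i z
    refine ⟨fun p => if hp : (p : ℕ) < F.m i.succ then z ⟨p, hp⟩ else false, ?_⟩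
    funext j
    simp

/-- The sizes of the blocks of the combination of two inputs. -/
def size (F G : Input n) (i : Fin (n + 1)) : ℕ := F.m i + G.m i + offset i

theorem size_zero (F G : Input n) : size F G 0 = F.m 0 + G.m 0 + 1 := rfl

theorem left_le_size (F G : Input n) (i : Fin (n + 1)) : F.m i + offset i ≤ size F G i := by
  simp only [size]; omega

theorem right_le_size (F G : Input n) (i : Fin (n + 1)) : G.m i + offset i ≤ size F G i := by
  simp only [size]; omega

/-- The expression of `F`, in the variables of the combination of `F` and `G`. -/
def left (F G : Input n) : BoolExpr ((i : Fin (n + 1)) × Fin (size F G i)) :=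
  F.expr.rename (shiftVar (left_le_size F G))

/-- The expression of `G`, in the variables of the combination of `F` and `G`. -/
def right (F G : Input n) : BoolExpr ((i : Fin (n + 1)) × Fin (size F G i)) :=
  G.expr.rename (shiftVar (right_le_size F G))

/-- The variables of the first block. -/
def bit (F G : Input n) (p : ℕ) (hp : p ≤ F.m 0 + G.m 0) :
    BoolExpr ((i : Fin (n + 1)) × Fin (size F G i)) :=
  .var ⟨0, ⟨p, by simp only [size_zero]; omega⟩⟩

def pinLeft (F G : Input n) (e : BoolExpr ((i : Fin (n + 1)) × Fin (size F G i))) :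
    BoolExpr ((i : Fin (n + 1)) × Fin (size F G i)) :=
  e.pins (F.m 0) (G.m 0) (by simp only [size_zero]; omega)

def pinRight (F G : Input n) (e : BoolExpr ((i : Fin (n + 1)) × Fin (size F G i))) :
    BoolExpr ((i : Fin (n + 1)) × Fin (size F G i)) :=
  e.pins (G.m 0) (F.m 0) (by simp only [size_zero]; omega)

/-- The function whose witnesses are `1 x 0…0` for the witnesses `x` of `F` and
`0 y 0…0` for the counterexamples `y` of `G`. -/
def combine (F G : Input n) : Input n where
  m := size F G
  pos := by simp only [size_zero]; omega
  expr :=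
    .or (.and (bit F G 0 (by omega)) (pinLeft F G (left F G)))
      (.and (.not (bit F G 0 (by omega))) (pinRight F G (.not (right F G))))

/-- The function whose witnesses are `1 x 0…0` for the witnesses `x` of `F` that begin with `1`.
The input `G` plays no role. -/
def selectOne (F G : Input n) : Input n where
  m := size F G
  pos := by simp only [size_zero]; omega
  expr :=
    .or (.and (bit F G 0 (by omega))
        (pinLeft F G (.and (bit F G 1 (by have := F.pos; omega)) (left F G))))
      (.and (.and (bit F G 0 (by omega)) (.not (bit F G 0 (by omega))))
        (pinRight F G (right F G)))

/-- The function whose counterexamples are `1 x 0…0` for the witnesses `x` of `F` that begin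
with `0`. The input `G` plays no role. -/
def selectZero (F G : Input n) : Input n where
  m := size F G
  pos := by simp only [size_zero]; omega
  expr :=
    .not (.or (.and (bit F G 0 (by omega))
        (pinLeft F G (.and (.not (bit F G 1 (by have := F.pos; omega))) (left F G))))
      (.and (.and (bit F G 0 (by omega)) (.not (bit F G 0 (by omega))))
        (pinRight F G (right F G))))

/-- The tag bit of `x` removes one disjunct. If the pinned bits are not all zero, the rest is
constantly false; otherwise it is the function of `F` or the negation of that of `G`, where
`alternating_not` turns a counterexample into a witness. -/
theorem coSAT_combine_fix (F G : Input n) (x : Fin (size F G 0) → Bool) :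
    CoSAT ((combine F G).fn.fix x) ↔
      (∃ z, x = pad true z ∧ CoSAT (F.fn.fix z)) ∨ ∃ z, x = pad false z ∧ ¬ SAT (G.fn.fix z) := by
  have h₁ : CoSAT ((combine F G).fn.fix x) ↔ Alternating (n := n) (m := fun i => size F G i.succ) false fun y =>
      (x ⟨0, by simp only [size_zero]; omega⟩ && (pinLeft F G (left F G)).slice x y ||
        !(x ⟨0, by simp only [size_zero]; omega⟩) &&
          (pinRight F G (.not (right F G))).slice x y) := Iff.rfl
  have h₂ : ∀ y, (BoolExpr.not (right F G)).slice x y = !((right F G).slice x y) := fun y => rfl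
  have hF := eq_pad_iff (x := x) (k := F.m 0) (by simp only [size_zero]; omega) true
  have hG := eq_pad_iff (x := x) (k := G.m 0) (by simp only [size_zero]; omega) false
  -- The last position of the first block is `F.m 0 + G.m 0`, so the pinning conditions reach its
  -- end and their upper bound can be dropped.
  have hp₁ : ∀ p : Fin (size F G 0), (p : ℕ) ≤ F.m 0 + G.m 0 := fun p => by
    have := p.2; simp only [size_zero] at this; omega
  have hp₂ : ∀ p : Fin (size F G 0), (p : ℕ) ≤ G.m 0 + F.m 0 := fun p => by
    have := hp₁ p; omega
  have hL := alternating_slice_rename F (left_le_size F G) false x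
  have hR := alternating_slice_rename G (right_le_size F G) true x
  rw [h₁]
  simp only [pinLeft, pinRight, BoolExpr.slice_pins, h₂, hp₁, hp₂, forall_const, hF, hG]
  simp only [CoSAT, SAT]
  rcases hx : x ⟨0, by simp only [size_zero]; omega⟩
  · by_cases hq : ∀ p : Fin (size F G 0), G.m 0 < p → x p = false
    · simp only [eq_true hq]
      simp [alternating_not, right, hR]
    · simp only [eq_false hq]
      simp [alternating_const]
  · by_cases hq : ∀ p : Fin (size F G 0), F.m 0 < p → x p = false
    · simp only [eq_true hq]
      simp [left, hL]
    · simp only [eq_false hq]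
      simp [alternating_const]

/-- The common core of `selectOne` and `selectZero`. The second disjunct contains a bit and its
negation and is false; it is there only to give these inputs the textual shape of `combine`. -/
theorem alternating_select (F G : Input n) (c : Bool) (x : Fin (size F G 0) → Bool) :
    Alternating (n := n) (m := fun i => size F G i.succ) false (fun y =>
      ((x ⟨0, by simp only [size_zero]; omega⟩ &&
          (decide (∀ p : Fin (size F G 0), F.m 0 < p → x p = false) &&
            ((x ⟨1, by have := F.pos; simp only [size_zero]; omega⟩ == c) && (left F G).slice x y)) ||
        x ⟨0, by simp only [size_zero]; omega⟩ && !(x ⟨0, by simp only [size_zero]; omega⟩) &&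
          (pinRight F G (right F G)).slice x y))) ↔
      ∃ z, x = pad true z ∧ z ⟨0, F.pos⟩ = c ∧ CoSAT (F.fn.fix z) := by
  have hF := eq_pad_iff (x := x) (k := F.m 0) (by simp only [size_zero]; omega) true
  have hL := alternating_slice_rename F (left_le_size F G) false x
  simp only [hF]
  simp only [CoSAT]
  rcases hx : x ⟨0, by simp only [size_zero]; omega⟩
  · simp [alternating_const]
  · by_cases hq : ∀ p : Fin (size F G 0), F.m 0 < p → x p = false
    · by_cases hc : x ⟨1, by have := F.pos; simp only [size_zero]; omega⟩ = c
      · simp only [eq_true hq]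
        simp [hc, left, hL]
      · have hc' : (x ⟨1, by have := F.pos; simp only [size_zero]; omega⟩ == c) = false := by
          simpa using hc
        simp only [eq_true hq, hc']
        simp [alternating_const]
        exact fun h => absurd h hc
    · simp only [eq_false hq]
      simp [alternating_const]

theorem coSAT_selectOne_fix (F G : Input n) (x : Fin (size F G 0) → Bool) :
    CoSAT ((selectOne F G).fn.fix x) ↔
      ∃ z, x = pad true z ∧ z ⟨0, F.pos⟩ = true ∧ CoSAT (F.fn.fix z) := by
  rw [← alternating_select F G true x]
  have h₁ : CoSAT ((selectOne F G).fn.fix x) ↔ Alternating (n := n) (m := fun i => size F G i.succ) false fun y =>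
      (x ⟨0, by simp only [size_zero]; omega⟩ && (pinLeft F G (.and (bit F G 1
          (by have := F.pos; omega)) (left F G))).slice x y ||
        (x ⟨0, by simp only [size_zero]; omega⟩ && !(x ⟨0, by simp only [size_zero]; omega⟩)) &&
          (pinRight F G (right F G)).slice x y) := Iff.rfl
  have h₂ : ∀ y, (BoolExpr.and (bit F G 1 (by have := F.pos; omega)) (left F G)).slice x y =
      (x ⟨1, by have := F.pos; simp only [size_zero]; omega⟩ && (left F G).slice x y) :=
    fun y => rfl
  have hp₁ : ∀ p : Fin (size F G 0), (p : ℕ) ≤ F.m 0 + G.m 0 := fun p => by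
    have := p.2; simp only [size_zero] at this; omega
  rw [h₁]
  simp only [pinLeft, BoolExpr.slice_pins, h₂, hp₁, forall_const, beq_true]

theorem not_SAT_selectZero_fix (F G : Input n) (x : Fin (size F G 0) → Bool) :
    ¬ SAT ((selectZero F G).fn.fix x) ↔
      ∃ z, x = pad true z ∧ z ⟨0, F.pos⟩ = false ∧ CoSAT (F.fn.fix z) := by
  rw [← alternating_select F G false x]
  have h₁ : SAT ((selectZero F G).fn.fix x) ↔ Alternating (n := n) (m := fun i => size F G i.succ) true fun y =>
      !(x ⟨0, by simp only [size_zero]; omega⟩ && (pinLeft F G (.and (.not (bit F G 1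
          (by have := F.pos; omega))) (left F G))).slice x y ||
        (x ⟨0, by simp only [size_zero]; omega⟩ && !(x ⟨0, by simp only [size_zero]; omega⟩)) &&
          (pinRight F G (right F G)).slice x y) := Iff.rfl
  have h₂ : ∀ y, (BoolExpr.and (.not (bit F G 1 (by have := F.pos; omega))) (left F G)).slice x y =
      (!(x ⟨1, by have := F.pos; simp only [size_zero]; omega⟩) && (left F G).slice x y) :=
    fun y => rfl
  have hp₁ : ∀ p : Fin (size F G 0), (p : ℕ) ≤ F.m 0 + G.m 0 := fun p => by
    have := p.2; simp only [size_zero] at this; omega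
  -- The input is a negation, so its counterexamples are the witnesses of what is negated.
  rw [h₁, alternating_not, not_not]
  simp only [pinLeft, BoolExpr.slice_pins, h₂, hp₁, forall_const, beq_false, Bool.not_true]

end Input

/-! ### Correctness of the three constructions -/

theorem promise_of_true {P : Prop} (h : P) {s : Set Bool} (hs : P → s.Nonempty) :
    (promise P s hs).1 = s := by
  simp [promise, h]

theorem promise_of_false {P : Prop} (h : ¬ P) {s : Set Bool} (hs : P → s.Nonempty) :
    (promise P s hs).1 = Set.univ := by
  simp [promise, h, anyAnswer]

theorem truth_of_true {P : Prop} (h : P) : truth P = true := by simp [truth, h]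

theorem truth_of_false {P : Prop} (h : ¬ P) : truth P = false := by simp [truth, h]

theorem sat_succ {n : ℕ} {m : Fin (n + 1) → ℕ} (f : BoolFun m) :
    SAT f ↔ ∃ x, CoSAT (f.fix x) := by
  simp only [SAT, CoSAT]; rw [Alternating]

theorem coSAT_succ {n : ℕ} {m : Fin (n + 1) → ℕ} (f : BoolFun m) :
    CoSAT f ↔ ∀ x, SAT (f.fix x) := by
  simp only [SAT, CoSAT]; rw [Alternating]

namespace Input

variable {n : ℕ}

/-- `S` stands for the valid answers of a problem that reduces to both sides. Each hypothesis puts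
the whole alphabet into `S` when its promise fails, and the correct letter otherwise. -/
theorem uval_combine_subset (F G : Input n) {S : Set Bool} (hF : F.usat.1 ⊆ S)
    (hG : G.coUsat.1 ⊆ S) : (combine F G).uval.1 ⊆ S := by
  by_cases pF : {x | CoSAT (F.fn.fix x)}.ncard ≤ 1
  swap
  · rw [usat, promise_of_false pF] at hF
    exact (Set.subset_univ _).trans hF
  by_cases pG : {x | ¬ SAT (G.fn.fix x)}.ncard ≤ 1
  swap
  · rw [coUsat, promise_of_false pG] at hG
    exact (Set.subset_univ _).trans hG
  rw [usat, promise_of_true pF, Set.singleton_subset_iff] at hF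
  rw [coUsat, promise_of_true pG, Set.singleton_subset_iff] at hG
  -- `Set.ncard` is `0` on infinite sets, so finiteness is needed to read the bound as uniqueness.
  have uF := (Set.ncard_le_one (Set.toFinite _)).1 pF
  have uG := (Set.ncard_le_one (Set.toFinite _)).1 pG
  by_cases sF : SAT F.fn <;> by_cases sG : CoSAT G.fn
  · rw [truth_of_true sF] at hF
    obtain ⟨z, hz⟩ := (sat_succ _).1 sF
    have key : ∀ x, CoSAT ((combine F G).fn.fix x) ↔ x = pad true z := by
      intro x
      refine (coSAT_combine_fix F G x).trans ?_
      constructor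
      · rintro (⟨z', rfl, hz'⟩ | ⟨z', -, hz'⟩)
        · exact congrArg _ (uF z' hz' z hz)
        · exact absurd ((coSAT_succ _).1 sG z') hz'
      · rintro rfl
        exact Or.inl ⟨z, rfl, hz⟩
    rw [uval, promise_of_true ⟨pad true z, (key _).2 rfl, fun y hy => (key _).1 hy⟩]
    rintro b ⟨x, hx, rfl⟩
    rw [(key x).1 hx, pad_zero]
    exact hF
  · rw [truth_of_true sF] at hF
    rw [truth_of_false sG] at hG
    -- The answers disagree, so both letters lie in `S` and nothing about the combined input is
    -- needed.
    rintro (_ | _) -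
    exacts [hG, hF]
  · rw [truth_of_false sF] at hF
    rw [truth_of_true sG] at hG
    rintro (_ | _) -
    exacts [hF, hG]
  · rw [truth_of_false sG] at hG
    obtain ⟨z, hz⟩ := not_forall.1 (mt (coSAT_succ _).2 sG)
    have key : ∀ x, CoSAT ((combine F G).fn.fix x) ↔ x = pad false z := by
      intro x
      refine (coSAT_combine_fix F G x).trans ?_
      constructor
      · rintro (⟨z', -, hz'⟩ | ⟨z', rfl, hz'⟩)
        · exact absurd ((sat_succ _).2 ⟨z', hz'⟩) sF
        · exact congrArg _ (uG z' hz' z hz)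
      · rintro rfl
        exact Or.inr ⟨z, rfl, hz⟩
    rw [uval, promise_of_true ⟨pad false z, (key _).2 rfl, fun y hy => (key _).1 hy⟩]
    rintro b ⟨x, hx, rfl⟩
    rw [(key x).1 hx, pad_zero]
    exact hG

/-- Under the promise of `uval`, the only candidate for a witness is the padded witness of `F`, and
it survives exactly when it begins with `1`. -/
theorem usat_selectOne_subset (F G : Input n) : (selectOne F G).usat.1 ⊆ F.uval.1 := by
  by_cases p : ∃! x, CoSAT (F.fn.fix x)
  swap
  · rw [uval, promise_of_false p]
    exact Set.subset_univ _
  obtain ⟨z, hz, uz⟩ := p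
  have hsub : {x | CoSAT ((selectOne F G).fn.fix x)} ⊆ {pad true z} := by
    intro x hx
    obtain ⟨z', rfl, -, hz'⟩ := (coSAT_selectOne_fix F G x).1 hx
    rw [uz z' hz']
    rfl
  rw [usat, promise_of_true ((Set.ncard_le_ncard hsub).trans (Set.ncard_singleton _).le),
    uval, promise_of_true ⟨z, hz, uz⟩, Set.singleton_subset_iff]
  refine ⟨z, hz, ?_⟩
  rcases h : z ⟨0, F.pos⟩
  · refine (truth_of_false fun hs => ?_).symm
    obtain ⟨x, hx⟩ := (sat_succ _).1 hs
    obtain ⟨z', -, h', hz'⟩ := (coSAT_selectOne_fix F G x).1 hx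
    rw [uz z' hz', h] at h'
    exact Bool.false_ne_true h'
  · exact (truth_of_true ((sat_succ _).2 ⟨pad true z,
      (coSAT_selectOne_fix F G _).2 ⟨z, rfl, h, hz⟩⟩)).symm

/-- Dually, the padded witness of `F` is a counterexample exactly when it begins with `0`, so
`CoSAT` holds exactly when its first bit is `1`. -/
theorem coUsat_selectZero_subset (F G : Input n) : (selectZero F G).coUsat.1 ⊆ F.uval.1 := by
  by_cases p : ∃! x, CoSAT (F.fn.fix x)
  swap
  · rw [uval, promise_of_false p]
    exact Set.subset_univ _
  obtain ⟨z, hz, uz⟩ := p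
  have hsub : {x | ¬ SAT ((selectZero F G).fn.fix x)} ⊆ {pad true z} := by
    intro x hx
    obtain ⟨z', rfl, -, hz'⟩ := (not_SAT_selectZero_fix F G x).1 hx
    rw [uz z' hz']
    rfl
  rw [coUsat, promise_of_true ((Set.ncard_le_ncard hsub).trans (Set.ncard_singleton _).le),
    uval, promise_of_true ⟨z, hz, uz⟩, Set.singleton_subset_iff]
  refine ⟨z, hz, ?_⟩
  rcases h : z ⟨0, F.pos⟩
  · exact (truth_of_false fun hs => (not_SAT_selectZero_fix F G (pad true z)).2 ⟨z, rfl, h, hz⟩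
      ((coSAT_succ _).1 hs _)).symm
  · refine (truth_of_true ((coSAT_succ _).2 fun x => ?_)).symm
    by_contra hx
    obtain ⟨z', -, h', hz'⟩ := (not_SAT_selectZero_fix F G x).1 hx
    rw [uz z' hz', h] at h'
    exact Bool.false_ne_true h'.symm

end Input

/-! ### The reductions as functions on strings -/

/-- The length of the block of ones at the beginning of a string. -/
def ones : List Bool → ℕ
  | true :: u => ones u + 1
  | _ => 0

/-- What remains of a string after a number in unary has been read. -/
def skip : List Bool → List Bool
  | true :: u => skip u
  | _ :: u => u
  | [] => []

theorem ones_unary (k : ℕ) (u : List Bool) : ones (unary k ++ u) = k := by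
  induction k with
  | zero => rfl
  | succ k ih => simpa [unary, List.replicate_succ, ones] using ih

theorem skip_unary (k : ℕ) (u : List Bool) : skip (unary k ++ u) = u := by
  induction k with
  | zero => rfl
  | succ k ih => simpa [unary, List.replicate_succ, skip] using ih

/-- The numbers of variables, added up for two inputs. -/
def addHeaders : ℕ → List Bool → List Bool → List Bool
  | 0, _, _ => []
  | k + 1, u, w => unary (ones u + ones w) ++ addHeaders k (skip u) (skip w)

theorem header_succ {n : ℕ} (m : Fin (n + 1) → ℕ) :
    header m = unary (m 0) ++ header (fun i : Fin n => m i.succ) := by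
  simp [header, List.ofFn_succ]

theorem addHeaders_header {n : ℕ} (m m' : Fin n → ℕ) (u w : List Bool) :
    addHeaders n (header m ++ u) (header m' ++ w) = header (fun i => m i + m' i) := by
  induction n with
  | zero => simp [addHeaders, header]
  | succ n ih =>
    simp only [header_succ, addHeaders, List.append_assoc, ones_unary, skip_unary, ih]

theorem skip_iterate_header {n : ℕ} (m : Fin n → ℕ) (u : List Bool) :
    skip^[n] (header m ++ u) = u := by
  induction n with
  | zero => simp [header]
  | succ n ih =>
    rw [Function.iterate_succ_apply, header_succ, List.append_assoc, skip_unary, ih]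

/-- The code of the variable number `p` of the first block. -/
def bitCode (p : ℕ) : List Bool := false :: false :: false :: unary p

/-- The code of the negations of the variables `a + 1, …, a + c` of the first block, each with the
tag of a conjunction. -/
def pinsCode : ℕ → ℕ → List Bool
  | _, 0 => []
  | a, c + 1 => true :: false :: false :: true :: (bitCode (a + 1) ++ pinsCode (a + 1) c)

/-- What a reader of the code of an expression expects next. -/
inductive Mode : Type
  | tag | secondOfVar | secondOfNot | block | blockRest | position
  deriving DecidableEq

instance : Fintype Mode where
  elems := {.tag, .secondOfVar, .secondOfNot, .block, .blockRest, .position}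
  complete q := by cases q <;> simp

namespace Mode

/-- The transducer that moves the variables of the first block one place: the next mode. -/
def next : Mode → Bool → Mode
  | tag, false => secondOfVar
  -- `secondOfNot` awaits the second letter of a binary tag; the tag of a negation is completed from
  -- `secondOfVar`.
  | tag, true => secondOfNot
  | secondOfVar, false => block
  | secondOfVar, true => tag
  | secondOfNot, _ => tag
  | block, false => position
  | block, true => blockRest
  | blockRest, false => position
  | blockRest, true => blockRest
  | position, false => tag
  | position, true => position

/-- The transducer that moves the variables of the first block one place: the output. -/
def emit : Mode → Bool → List Bool
  -- A `0` in mode `block` says that the variable is in block 0; the additional `1` raises the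
  -- position that follows by one.
  | block, false => [false, true]
  | _, b => [b]

/-- The transducer that moves the variables of the first block one place. -/
def run : Mode → List Bool → List Bool
  | _, [] => []
  | q, b :: u => q.emit b ++ (q.next b).run u

theorem run_position (j : ℕ) (u : List Bool) :
    position.run (unary j ++ u) = unary j ++ tag.run u := by
  induction j with
  | zero => rfl
  | succ j ih =>
    simp only [unary, List.replicate_succ, List.cons_append] at ih ⊢
    simp only [run, emit, next, ih, List.singleton_append]

theorem run_blockRest (i : ℕ) (u : List Bool) :
    blockRest.run (unary i ++ u) = unary i ++ position.run u := by
  induction i with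
  | zero => rfl
  | succ i ih =>
    simp only [unary, List.replicate_succ, List.cons_append] at ih ⊢
    simp only [run, emit, next, ih, List.singleton_append]

/-- In prefix notation every letter's role is known from a bounded state, so variables can be
renamed without parsing the expression. Only those of block 0 change. -/
theorem run_code {n : ℕ} {m M : Fin (n + 1) → ℕ} (h : ∀ i, m i + offset i ≤ M i)
    (e : BoolExpr ((i : Fin (n + 1)) × Fin (m i))) (u : List Bool) :
    tag.run (e.code ++ u) = (e.rename (shiftVar h)).code ++ tag.run u := by
  induction e generalizing u with
  | var v =>
    obtain ⟨i, j⟩ := v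
    simp only [BoolExpr.code, BoolExpr.rename, shiftVar, List.cons_append, run, emit, next,
      List.append_assoc, List.nil_append]
    refine congrArg _ (congrArg _ ?_)
    rcases Nat.eq_zero_or_pos (i : ℕ) with hi | hi
    · obtain rfl : i = 0 := Fin.ext hi
      simp only [offset, if_true]
      simp [unary, run, emit, next, List.replicate_succ]
      simpa [unary] using run_position j u
    · have hi' : i ≠ 0 := fun h => by simp [h] at hi
      obtain ⟨k, hk⟩ := Nat.exists_eq_succ_of_ne_zero hi.ne'
      have hb := run_blockRest k (unary j ++ u)
      rw [run_position] at hb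
      simp only [offset, if_neg hi', hk, Nat.succ_eq_add_one, Nat.add_zero]
      simp only [unary, List.replicate_succ, List.cons_append] at hb ⊢
      simp only [run, emit, next, hb, List.singleton_append]
  | not e ih => simp [BoolExpr.code, BoolExpr.rename, run, emit, next, ih]
  | and e₁ e₂ ih₁ ih₂ => simp [BoolExpr.code, BoolExpr.rename, run, emit, next, ih₁, ih₂]
  | or e₁ e₂ ih₁ ih₂ => simp [BoolExpr.code, BoolExpr.rename, run, emit, next, ih₁, ih₂]

end Mode

/-- The pieces of text that a reduction inserts before (`pre`) and after (`mid`) the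
conditions that pin down the variables, for each of the two inputs. -/
structure Template : Type where
  pre : Bool → List Bool
  mid : Bool → List Bool

namespace Template

/-- The string that the reduction with template `t` makes of two strings. -/
def apply (t : Template) (k : ℕ) (u w : List Bool) : List Bool :=
  -- This `1` enlarges the first block by the tag variable.
  true :: (addHeaders k u w ++
    (t.pre false ++ (pinsCode (ones u) (ones w) ++
      (t.mid false ++ (Mode.tag.run (skip^[k] u) ++
    (t.pre true ++ (pinsCode (ones w) (ones u) ++
      (t.mid true ++ Mode.tag.run (skip^[k] w)))))))))

end Template

theorem BoolExpr.code_pins {n : ℕ} {m : Fin (n + 1) → ℕ}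
    (e : BoolExpr ((i : Fin (n + 1)) × Fin (m i))) (a c : ℕ) (h : a + c < m 0) :
    (e.pins a c h).code = pinsCode a c ++ e.code := by
  induction c generalizing a with
  | zero => rfl
  | succ c ih =>
    simp only [pins, pinsCode, code, ih]
    simp [bitCode, unary]

namespace Input

variable {n : ℕ}

/-- The reason for block sizes that are sums: adding numbers in unary is concatenating their ones.
-/
theorem header_size (F G : Input n) :
    header (size F G) = true :: header (fun i => F.m i + G.m i) := by
  simp [header_succ, size, offset, unary, List.replicate_succ]

theorem apply_code (t : Template) (F G : Input n) :
    t.apply (n + 1) F.code.1 G.code.1 = header (size F G) ++ (t.pre false ++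
      (pinsCode (F.m 0) (G.m 0) ++ (t.mid false ++ ((left F G).code ++
        (t.pre true ++ (pinsCode (G.m 0) (F.m 0) ++ (t.mid true ++ (right F G).code))))))) := by
  have hF : ones F.code.1 = F.m 0 := by
    simp only [code, header_succ, List.append_assoc, ones_unary]
  have hG : ones G.code.1 = G.m 0 := by
    simp only [code, header_succ, List.append_assoc, ones_unary]
  have hL := Mode.run_code (left_le_size F G) F.expr []
  have hR := Mode.run_code (right_le_size F G) G.expr []
  simp only [List.append_nil, Mode.run] at hL hR
  rw [Template.apply, hF, hG]
  simp only [code, addHeaders_header, skip_iterate_header, hL, hR, header_size]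
  rfl

end Input

/-- The template of `Input.combine`. -/
def combineTemplate : Template where
  pre
    | false => [true, true, true, false] ++ bitCode 0
    | true => [true, false, false, true] ++ bitCode 0
  mid
    | false => []
    | true => [false, true]

/-- The template of `Input.selectOne`. -/
def selectOneTemplate : Template where
  pre
    | false => [true, true, true, false] ++ bitCode 0
    | true => [true, false, true, false] ++ bitCode 0 ++ [false, true] ++ bitCode 0
  mid
    | false => [true, false] ++ bitCode 1
    | true => []

/-- The template of `Input.selectZero`. -/
def selectZeroTemplate : Template where
  pre
    | false => [false, true, true, true, true, false] ++ bitCode 0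
    | true => [true, false, true, false] ++ bitCode 0 ++ [false, true] ++ bitCode 0
  mid
    | false => [true, false, false, true] ++ bitCode 1
    | true => []

namespace Input

variable {n : ℕ}

theorem combine_code (F G : Input n) :
    (combine F G).code.1 = combineTemplate.apply (n + 1) F.code.1 G.code.1 := by
  rw [apply_code]
  simp [code, combine, combineTemplate, BoolExpr.code, pinLeft, pinRight, BoolExpr.code_pins, bit,
    bitCode, unary]

theorem selectOne_code (F G : Input n) :
    (selectOne F G).code.1 = selectOneTemplate.apply (n + 1) F.code.1 G.code.1 := by
  rw [apply_code]
  simp [code, selectOne, selectOneTemplate, BoolExpr.code, pinLeft, pinRight, BoolExpr.code_pins,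
    bit, bitCode, unary]

theorem selectZero_code (F G : Input n) :
    (selectZero F G).code.1 = selectZeroTemplate.apply (n + 1) F.code.1 G.code.1 := by
  rw [apply_code]
  simp [code, selectZero, selectZeroTemplate, BoolExpr.code, pinLeft, pinRight, BoolExpr.code_pins,
    bit, bitCode, unary]

end Input

theorem Template.apply_ne_nil (t : Template) (k : ℕ) (u w : List Bool) : t.apply k u w ≠ [] := by
  simp [apply]

/-- The reduction with template `t`, as a function of two strings. -/
def Template.applyStr (t : Template) (k : ℕ) (u w : Str) : Str :=
  ⟨t.apply k u.1 w.1, t.apply_ne_nil k u.1 w.1⟩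

theorem onCodes_code {n : ℕ} (A : Input n → Answer) (F : Input n) : onCodes A F.code = A F :=
  (Input.code_injective n).extend_apply _ _ _

theorem onCodes_of_not_code {n : ℕ} (A : Input n → Answer) {x : Str}
    (h : ¬ ∃ F : Input n, F.code = x) : (onCodes A x).1 = Set.univ := by
  rw [onCodes, Function.extend_apply' _ _ _ h]
  rfl

open Turing Function

/-! ### Counting the steps of a machine -/

/-- `f` leads from `a` to `b` in at most `t` steps. -/
def Within {α : Type*} (f : α → Option α) (t : ℕ) (a b : α) : Prop :=
  ∃ s ≤ t, (flip bind f)^[s] (some a) = some b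

namespace Within

variable {α : Type*} {f : α → Option α} {s t : ℕ} {a b c : α}

theorem refl : Within f 0 a a := ⟨0, le_rfl, rfl⟩

theorem mono (h : Within f s a b) (hst : s ≤ t) : Within f t a b :=
  let ⟨r, hr, h'⟩ := h
  ⟨r, hr.trans hst, h'⟩

theorem trans (h₁ : Within f s a b) (h₂ : Within f t b c) : Within f (s + t) a c := by
  obtain ⟨r₁, hr₁, h₁⟩ := h₁
  obtain ⟨r₂, hr₂, h₂⟩ := h₂
  exact ⟨r₂ + r₁, by omega, by rw [Function.iterate_add_apply, h₁, h₂]⟩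

theorem single (h : f a = some b) : Within f 1 a b := ⟨1, le_rfl, h⟩

theorem head (h : f a = some b) (h' : Within f t b c) : Within f (t + 1) a c :=
  ((single h).trans h').mono (by omega)

end Within

theorem iterate_bind_none {α : Type*} (f : α → Option α) (s : ℕ) :
    (flip bind f)^[s] none = none := by
  induction s with
  | zero => rfl
  | succ s ih => rw [Function.iterate_succ_apply]; exact ih

/-! ### Bounding the stacks of a machine -/

section

variable {K : Type} [DecidableEq K] {Γ : K → Type} {Λ σ : Type}

/-- The number of push instructions in a statement. -/
def pushCount : TM2.Stmt Γ Λ σ → ℕ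
  | .push _ _ q => pushCount q + 1
  | .peek _ _ q => pushCount q
  | .pop _ _ q => pushCount q
  | .load _ q => pushCount q
  | .branch _ q₁ q₂ => pushCount q₁ + pushCount q₂
  | .goto _ => 0
  | .halt => 0

theorem length_stepAux_le (q : TM2.Stmt Γ Λ σ) (v : σ) (S : ∀ k, List (Γ k)) (k : K) :
    ((TM2.stepAux q v S).stk k).length ≤ (S k).length + pushCount q := by
  induction q generalizing v S with
  | push k' g q ih =>
    refine (ih _ _).trans ?_
    by_cases h : k = k'
    · subst h; simp only [update_self, List.length_cons, pushCount]; omega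
    · simp only [update_of_ne h, pushCount]; omega
  | peek k' g q ih => exact ih _ _
  | pop k' g q ih =>
    refine (ih _ _).trans ?_
    by_cases h : k = k'
    · subst h; simp [pushCount]
    · simp [Function.update_of_ne h, pushCount]
  | load g q ih => exact ih _ _
  | branch g q₁ q₂ ih₁ ih₂ =>
    simp only [TM2.stepAux, pushCount]
    cases g v
    · exact (ih₂ _ _).trans (by omega)
    · exact (ih₁ _ _).trans (by omega)
  | goto g => exact Nat.le_add_right _ _
  | halt => exact Nat.le_add_right _ _

/-- A statement has no loops, so one step adds a bounded number of symbols to a stack. This bounds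
the outputs of the called machines and, later, the height of the output stack of the calling one. -/
theorem length_iterate_le {m : Λ → TM2.Stmt Γ Λ σ} {C : ℕ} (hC : ∀ l, pushCount (m l) ≤ C) (k : K)
    (s : ℕ) {c c' : TM2.Cfg Γ Λ σ} (h : (flip bind (TM2.step m))^[s] (some c) = some c') :
    (c'.stk k).length ≤ (c.stk k).length + C * s := by
  induction s generalizing c with
  | zero =>
    obtain rfl : c = c' := by simpa using h
    simp
  | succ s ih =>
    rw [Function.iterate_succ_apply] at h
    obtain ⟨_ | l, v, S⟩ := c
    · have h' : (flip bind (TM2.step m))^[s] none = some c' := h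
      rw [iterate_bind_none] at h'
      exact absurd h' (by simp)
    · have h' : (flip bind (TM2.step m))^[s] (some (TM2.stepAux (m l) v S)) = some c' := h
      refine (ih h').trans ?_
      have h₁ := length_stepAux_le (m l) v S k
      have h₂ := hC l
      have h₃ : C * (s + 1) = C * s + C := by ring
      simp only
      omega

end

theorem initList_eq (tm : FinTM2) (s : List (tm.Γ tm.k₀)) :
    initList tm s = ⟨some tm.main, tm.initialState, update (fun _ => []) tm.k₀ s⟩ := by
  unfold initList
  congr 1
  funext k
  by_cases h : k = tm.k₀
  · subst h; simp
  · simp [h]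

/-- A proper halt requires the initial state and all stacks empty except the output. Hence the
program empties its counters and forgets the symbol it has read. -/
theorem haltList_eq (tm : FinTM2) (s : List (tm.Γ tm.k₁)) :
    haltList tm s = ⟨none, tm.initialState, update (fun _ => []) tm.k₁ s⟩ := by
  unfold haltList
  congr 1
  funext k
  by_cases h : k = tm.k₁
  · subst h; simp
  · simp [h]

/-! ### A machine that calls two machines and merges their outputs -/

/-- Two machines, the identification of their alphabets with `{0, 1}`, and the parameters of
the function that merges their outputs. -/
structure Callees where
  M : Bool → FinTM2
  enc : ∀ b, (M b).Γ (M b).k₀ ≃ Bool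
  dec : ∀ b, (M b).Γ (M b).k₁ ≃ Bool
  t : Template
  n : ℕ

/-- The stacks that do not belong to the called machines. -/
inductive Tape : Type
  | io | rev | tmp
  | lo (b : Bool)
  | cnt (b : Bool)
  deriving DecidableEq, Fintype

/-- The contents of these stacks. -/
structure Tapes where
  io : List Bool
  rev : List Bool
  tmp : List Bool
  lo : Bool → List Bool
  cnt : Bool → List Bool

def Tapes.get (T : Tapes) : Tape → List Bool
  | .io => T.io
  | .rev => T.rev
  | .tmp => T.tmp
  | .lo b => T.lo b
  | .cnt b => T.cnt b

/-- The labels that do not belong to the called machines. -/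
inductive Label (n : ℕ) : Type
  | unload | load | fin
  | first (b : Bool)
  | blocks (i : Fin n) (b : Bool)
  | pin (b : Bool)
  | pinCopy (b : Bool)
  | pinRestore (b : Bool)
  | shift (b : Bool) (q : Mode)
  | clear (b : Bool)
  deriving Fintype

namespace Callees

variable (P : Callees)

abbrev K : Type := (Σ b, (P.M b).K) ⊕ Tape

abbrev Γ : P.K → Type := Sum.elim (fun p => (P.M p.1).Γ p.2) (fun _ => Bool)

abbrev Λ : Type := (Σ b, (P.M b).Λ) ⊕ Label P.n

/-- The state of each called machine, and the last symbol read by the calling machine. -/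
abbrev State : Type := (∀ b, (P.M b).σ) × Option Bool

abbrev Code : Type := TM2.Stmt P.Γ P.Λ P.State

abbrev Config : Type := TM2.Cfg P.Γ P.Λ P.State

def join (V : ∀ b k, List ((P.M b).Γ k)) (T : Tapes) : ∀ k : P.K, List (P.Γ k)
  | .inl ⟨b, k⟩ => V b k
  | .inr o => T.get o

section join

variable (V : ∀ b k, List ((P.M b).Γ k)) (T : Tapes)

theorem update_join_inl (b : Bool) (k : (P.M b).K) (l : List ((P.M b).Γ k)) :
    update (P.join V T) (.inl ⟨b, k⟩ : P.K) l = P.join (update V b (update (V b) k l)) T := by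
  refine update_eq_iff.2 ⟨?_, ?_⟩
  · change l = update V b (update (V b) k l) b k
    rw [update_self, update_self]
  · rintro (⟨b', k'⟩ | o) hx
    · change V b' k' = update V b (update (V b) k l) b' k'
      by_cases hb : b' = b
      · subst hb
        have hk : k' ≠ k := fun h => hx (by rw [h])
        rw [update_self, update_of_ne hk]
      · rw [update_of_ne hb]
    · rfl

theorem update_join_io (l : List Bool) :
    update (P.join V T) (.inr .io : P.K) l = P.join V { T with io := l } := by
  refine update_eq_iff.2 ⟨rfl, ?_⟩
  rintro (p | o) hx
  · rfl
  · cases o <;> first | rfl | exact absurd rfl hx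

theorem update_join_rev (l : List Bool) :
    update (P.join V T) (.inr .rev : P.K) l = P.join V { T with rev := l } := by
  refine update_eq_iff.2 ⟨rfl, ?_⟩
  rintro (p | o) hx
  · rfl
  · cases o <;> first | rfl | exact absurd rfl hx

theorem update_join_tmp (l : List Bool) :
    update (P.join V T) (.inr .tmp : P.K) l = P.join V { T with tmp := l } := by
  refine update_eq_iff.2 ⟨rfl, ?_⟩
  rintro (p | o) hx
  · rfl
  · cases o <;> first | rfl | exact absurd rfl hx

theorem update_join_lo (b : Bool) (l : List Bool) :
    update (P.join V T) (.inr (.lo b) : P.K) l =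
      P.join V { T with lo := update T.lo b l } := by
  refine update_eq_iff.2 ⟨?_, ?_⟩
  · change l = update T.lo b l b
    rw [update_self]
  · rintro (p | o) hx
    · rfl
    · cases o with
      | lo b' =>
        have hb : b' ≠ b := fun h => hx (by rw [h])
        change T.lo b' = update T.lo b l b'
        rw [update_of_ne hb]
      | _ => rfl

theorem update_join_cnt (b : Bool) (l : List Bool) :
    update (P.join V T) (.inr (.cnt b) : P.K) l =
      P.join V { T with cnt := update T.cnt b l } := by
  refine update_eq_iff.2 ⟨?_, ?_⟩
  · change l = update T.cnt b l b
    rw [update_self]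
  · rintro (p | o) hx
    · rfl
    · cases o with
      | cnt b' =>
        have hb : b' ≠ b := fun h => hx (by rw [h])
        change T.cnt b' = update T.cnt b l b'
        rw [update_of_ne hb]
      | _ => rfl

end join

/-! ### The program -/

/-- Runs a statement of the called machine `b`; its end is a jump to the label `next`. -/
def lift (b : Bool) (next : P.Λ) : TM2.Stmt (P.M b).Γ (P.M b).Λ (P.M b).σ → P.Code
  | .push k g q => .push (.inl ⟨b, k⟩) (fun v => g (v.1 b)) (lift b next q)
  | .peek k g q => .peek (.inl ⟨b, k⟩) (fun v s => (update v.1 b (g (v.1 b) s), v.2))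
      (lift b next q)
  | .pop k g q => .pop (.inl ⟨b, k⟩) (fun v s => (update v.1 b (g (v.1 b) s), v.2))
      (lift b next q)
  | .load g q => .load (fun v => (update v.1 b (g (v.1 b)), v.2)) (lift b next q)
  | .branch g q₁ q₂ => .branch (fun v => g (v.1 b)) (lift b next q₁) (lift b next q₂)
  | .goto g => .goto fun v => .inl ⟨b, g (v.1 b)⟩
  | .halt => .goto fun _ => next

/-- Pops a symbol and runs one of three statements, depending on that symbol. -/
def popCase (k : P.K) (d : P.Γ k → Bool) (q : Option Bool → P.Code) : P.Code :=
  .pop k (fun v s => (v.1, s.map d)) <|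
    -- The symbol is erased before going on, so that the second component is `none` whenever a
    -- continuation begins.
    .branch (fun v => v.2 == some true) (.load (fun v => (v.1, none)) (q (some true))) <|
    .branch (fun v => v.2 == some false) (.load (fun v => (v.1, none)) (q (some false))) (q none)

/-- Pushes a symbol on a stack of the calling machine. -/
def put (o : Tape) (c : Bool) (q : P.Code) : P.Code := .push (.inr o) (fun _ => c) q

/-- Pushes a string on the output, which is written in reversed order. -/
def write (l : List Bool) (q : P.Code) : P.Code := l.foldr (P.put .rev) q

def jump (l : P.Λ) : P.Code := .goto fun _ => l

/-- The statement that is run when all blocks but `i` have been processed. -/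
def enter : (i : ℕ) → i ≤ P.n → P.Code
  | 0, _ => P.write (P.t.pre false) (P.jump (.inr (.pin false)))
  | i + 1, h => P.jump (.inr (.blocks ⟨i, h⟩ false))

def out (b : Bool) : P.K := .inl ⟨b, (P.M b).k₁⟩

/-- The label at which the machine goes on when the called machine `b` has halted. -/
def after : Bool → P.Λ
  | false => .inl ⟨true, (P.M true).main⟩
  | true => .inr (.first false)

/-- The part of the program that does not belong to the called machines. -/
def body : Label P.n → P.Code
  | .unload => P.popCase (.inr .io) id fun
    | some c => P.put .tmp c (P.jump (.inr .unload))
    | none => P.jump (.inr .load)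
  | .load => P.popCase (.inr .tmp) id fun
    | some c => .push (.inl ⟨false, (P.M false).k₀⟩) (fun _ => (P.enc false).symm c) <|
        .push (.inl ⟨true, (P.M true).k₀⟩) (fun _ => (P.enc true).symm c) <|
        P.jump (.inr .load)
    -- The header begins with the `1` of the tag variable.
    | none => P.put .rev true (P.jump (.inl ⟨false, (P.M false).main⟩))
  | .first b => P.popCase (P.out b) (P.dec b) fun
    -- Besides being part of the header, the size of the first block of input `b` is where the
    -- pinned variables for `b` begin (`lo b`) and how many are pinned for the other input (`cnt
    -- (!b)`).
    | some true => P.put .rev true <| P.put (.lo b) true <| P.put (.cnt (!b)) true <|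
        P.jump (.inr (.first b))
    -- An exhausted stack ends a number as a `0` does, in agreement with `ones` and `skip`. Only the
    -- second number is closed by a `0`, so the two are added.
    | _ => match b with
      | false => P.jump (.inr (.first true))
      | true => P.put .rev false (P.enter P.n le_rfl)
  | .blocks i b => P.popCase (P.out b) (P.dec b) fun
    | some true => P.put .rev true <| P.jump (.inr (.blocks i b))
    | _ => match b with
      | false => P.jump (.inr (.blocks i true))
      | true => P.put .rev false (P.enter i i.2.le)
  | .pin b => P.popCase (.inr (.cnt b)) id fun
    -- The tags of a conjunction, a negation and a variable, the `0` for block 0, and the first `1`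
    -- of the position `a + 1`, where `a` is the height of `lo b`.
    | some _ => P.write [true, false, false, true, false, false, false, true] <|
        P.jump (.inr (.pinCopy b))
    | none => P.write (P.t.mid b) (P.jump (.inr (.shift b .tag)))
  | .pinCopy b => P.popCase (.inr (.lo b)) id fun
    | some _ => P.put .rev true <| P.put .tmp true <| P.jump (.inr (.pinCopy b))
    -- The additional symbol makes the restored counter larger by one, ready for the next pinned
    -- variable.
    | none => P.put .rev false <| P.put .tmp true <| P.jump (.inr (.pinRestore b))
  | .pinRestore b => P.popCase (.inr .tmp) id fun
    | some _ => P.put (.lo b) true <| P.jump (.inr (.pinRestore b))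
    | none => P.jump (.inr (.pin b))
  | .shift b q => P.popCase (P.out b) (P.dec b) fun
    | some c => P.write (q.emit c) <| P.jump (.inr (.shift b (q.next c)))
    | none => P.jump (.inr (.clear b))
  | .clear b => P.popCase (.inr (.lo b)) id fun
    | some _ => P.jump (.inr (.clear b))
    | none => match b with
      | false => P.write (P.t.pre true) (P.jump (.inr (.pin true)))
      | true => P.jump (.inr .fin)
  | .fin => P.popCase (.inr .rev) id fun
    | some c => P.put .io c (P.jump (.inr .fin))
    | none => .halt

def program : P.Λ → P.Code
  | .inl ⟨b, l⟩ => P.lift b (P.after b) ((P.M b).m l)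
  | .inr l => P.body l

/-- The machine. -/
def machine : FinTM2 where
  K := P.K
  kFin := by haveI := fun b => (P.M b).kFin; infer_instance
  k₀ := .inr .io
  k₁ := .inr .io
  Γ := P.Γ
  Λ := P.Λ
  main := .inr .unload
  ΛFin := by haveI := fun b => (P.M b).ΛFin; infer_instance
  σ := P.State
  initialState := (fun b => (P.M b).initialState, none)
  σFin := by haveI := fun b => (P.M b).σFin; infer_instance
  Γk₀Fin := inferInstanceAs (Fintype Bool)
  m := P.program

end Callees

theorem replicate_append_cons (k : ℕ) (s : List Bool) :
    List.replicate k true ++ true :: s = true :: (List.replicate k true ++ s) := by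
  rw [List.append_cons, ← List.replicate_succ', List.replicate_succ, List.cons_append]

namespace Callees

variable (P : Callees)

/-! ### Single steps -/

/-- The configuration with label `l` in which the called machines are in their initial states. -/
def conf (l : P.Λ) (V : ∀ b k, List ((P.M b).Γ k)) (T : Tapes) : P.Config :=
  ⟨some l, (fun b => (P.M b).initialState, none), P.join V T⟩

/-- The stacks of the called machines, when both have halted with outputs `U`. -/
def outputs (U : Bool → List Bool) (b : Bool) : ∀ k, List ((P.M b).Γ k) :=
  update (fun _ => []) (P.M b).k₁ ((U b).map (P.dec b).symm)

/-- The stacks of the called machines, when both are given the input `x`. -/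
def inputs (x : List Bool) (b : Bool) : ∀ k, List ((P.M b).Γ k) :=
  update (fun _ => []) (P.M b).k₀ (x.map (P.enc b).symm)

section steps

variable (V : ∀ b k, List ((P.M b).Γ k)) (T : Tapes) (v : ∀ b, (P.M b).σ)

theorem stepAux_popCase (k : P.K) (d : P.Γ k → Bool) (q : Option Bool → P.Code)
    (S : ∀ k, List (P.Γ k)) :
    TM2.stepAux (P.popCase k d q) (v, none) S =
      TM2.stepAux (q ((S k).head?.map d)) (v, none) (update S k (S k).tail) := by
  simp only [popCase, TM2.stepAux]
  rcases (S k).head?.map d with _ | _ | _ <;> rfl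

theorem stepAux_popCase_io (q : Option Bool → P.Code) :
    TM2.stepAux (P.popCase (.inr .io) id q) (v, none) (P.join V T) =
      TM2.stepAux (q T.io.head?) (v, none) (P.join V { T with io := T.io.tail }) := by
  have h : ((P.join V T (.inr .io)).head?.map id : Option Bool) = T.io.head? :=
    congrFun Option.map_id _
  exact (P.stepAux_popCase v (.inr .io) id q (P.join V T)).trans
    (congrArg₂ (fun o S => TM2.stepAux (q o) (v, none) S) h (P.update_join_io V T _))

theorem stepAux_popCase_rev (q : Option Bool → P.Code) :
    TM2.stepAux (P.popCase (.inr .rev) id q) (v, none) (P.join V T) =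
      TM2.stepAux (q T.rev.head?) (v, none) (P.join V { T with rev := T.rev.tail }) := by
  have h : ((P.join V T (.inr .rev)).head?.map id : Option Bool) = T.rev.head? :=
    congrFun Option.map_id _
  exact (P.stepAux_popCase v (.inr .rev) id q (P.join V T)).trans
    (congrArg₂ (fun o S => TM2.stepAux (q o) (v, none) S) h (P.update_join_rev V T _))

theorem stepAux_popCase_tmp (q : Option Bool → P.Code) :
    TM2.stepAux (P.popCase (.inr .tmp) id q) (v, none) (P.join V T) =
      TM2.stepAux (q T.tmp.head?) (v, none) (P.join V { T with tmp := T.tmp.tail }) := by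
  have h : ((P.join V T (.inr .tmp)).head?.map id : Option Bool) = T.tmp.head? :=
    congrFun Option.map_id _
  exact (P.stepAux_popCase v (.inr .tmp) id q (P.join V T)).trans
    (congrArg₂ (fun o S => TM2.stepAux (q o) (v, none) S) h (P.update_join_tmp V T _))

theorem stepAux_popCase_lo (b : Bool) (q : Option Bool → P.Code) :
    TM2.stepAux (P.popCase (.inr (.lo b)) id q) (v, none) (P.join V T) =
      TM2.stepAux (q (T.lo b).head?) (v, none)
        (P.join V { T with lo := update T.lo b (T.lo b).tail }) := by
  have h : ((P.join V T (.inr (.lo b))).head?.map id : Option Bool) = (T.lo b).head? :=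
    congrFun Option.map_id _
  exact (P.stepAux_popCase v (.inr (.lo b)) id q (P.join V T)).trans
    (congrArg₂ (fun o S => TM2.stepAux (q o) (v, none) S) h (P.update_join_lo V T b _))

theorem stepAux_popCase_cnt (b : Bool) (q : Option Bool → P.Code) :
    TM2.stepAux (P.popCase (.inr (.cnt b)) id q) (v, none) (P.join V T) =
      TM2.stepAux (q (T.cnt b).head?) (v, none)
        (P.join V { T with cnt := update T.cnt b (T.cnt b).tail }) := by
  have h : ((P.join V T (.inr (.cnt b))).head?.map id : Option Bool) = (T.cnt b).head? :=
    congrFun Option.map_id _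
  exact (P.stepAux_popCase v (.inr (.cnt b)) id q (P.join V T)).trans
    (congrArg₂ (fun o S => TM2.stepAux (q o) (v, none) S) h (P.update_join_cnt V T b _))

theorem update_outputs (U : Bool → List Bool) (b : Bool) (l : List Bool) :
    update (P.outputs U) b (update (P.outputs U b) (P.M b).k₁ (l.map (P.dec b).symm)) =
      P.outputs (update U b l) := by
  refine update_eq_iff.2 ⟨?_, fun b' hb => ?_⟩
  · simp [outputs]
  · simp [outputs, hb]

theorem stepAux_popCase_out (U : Bool → List Bool) (b : Bool) (q : Option Bool → P.Code) :
    TM2.stepAux (P.popCase (P.out b) (P.dec b) q) (v, none) (P.join (P.outputs U) T) =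
      TM2.stepAux (q (U b).head?) (v, none) (P.join (P.outputs (update U b (U b).tail)) T) := by
  have h : P.join (P.outputs U) T (P.out b) = (U b).map (P.dec b).symm := by
    change P.outputs U b (P.M b).k₁ = _
    rw [outputs, update_self]
  have h₁ : (P.join (P.outputs U) T (P.out b)).head?.map (P.dec b) = (U b).head? := by
    rw [h]
    cases U b with
    | nil => rfl
    | cons c l => exact congrArg some ((P.dec b).apply_symm_apply c)
  have h₂ : update (P.join (P.outputs U) T) (P.out b) (P.join (P.outputs U) T (P.out b)).tail =
      P.join (P.outputs (update U b (U b).tail)) T := by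
    rw [h, ← update_outputs, List.map_tail]
    exact P.update_join_inl (P.outputs U) T b _ _
  exact (P.stepAux_popCase v (P.out b) (P.dec b) q _).trans
    (congrArg₂ (fun o S => TM2.stepAux (q o) (v, none) S) h₁ h₂)

theorem stepAux_put_io (c : Bool) (q : P.Code) (v : P.State) :
    TM2.stepAux (P.put .io c q) v (P.join V T) =
      TM2.stepAux q v (P.join V { T with io := c :: T.io }) := 
  congrArg (TM2.stepAux q v) (P.update_join_io V T _)

theorem stepAux_put_rev (c : Bool) (q : P.Code) (v : P.State) :
    TM2.stepAux (P.put .rev c q) v (P.join V T) =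
      TM2.stepAux q v (P.join V { T with rev := c :: T.rev }) := 
  congrArg (TM2.stepAux q v) (P.update_join_rev V T _)

theorem stepAux_put_tmp (c : Bool) (q : P.Code) (v : P.State) :
    TM2.stepAux (P.put .tmp c q) v (P.join V T) =
      TM2.stepAux q v (P.join V { T with tmp := c :: T.tmp }) := 
  congrArg (TM2.stepAux q v) (P.update_join_tmp V T _)

theorem stepAux_put_lo (b c : Bool) (q : P.Code) (v : P.State) :
    TM2.stepAux (P.put (.lo b) c q) v (P.join V T) =
      TM2.stepAux q v (P.join V { T with lo := update T.lo b (c :: T.lo b) }) := 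
  congrArg (TM2.stepAux q v) (P.update_join_lo V T b _)

theorem stepAux_put_cnt (b c : Bool) (q : P.Code) (v : P.State) :
    TM2.stepAux (P.put (.cnt b) c q) v (P.join V T) =
      TM2.stepAux q v (P.join V { T with cnt := update T.cnt b (c :: T.cnt b) }) := 
  congrArg (TM2.stepAux q v) (P.update_join_cnt V T b _)

theorem stepAux_write (l : List Bool) (q : P.Code) (v : P.State) :
    TM2.stepAux (P.write l q) v (P.join V T) =
      TM2.stepAux q v (P.join V { T with rev := l.reverse ++ T.rev }) := by
  induction l generalizing T with
  | nil => rfl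
  | cons c l ih =>
    have h : P.write (c :: l) q = P.put .rev c (P.write l q) := rfl
    rw [h, stepAux_put_rev, ih]
    simp

theorem stepAux_jump (l : P.Λ) :
    TM2.stepAux (P.jump l) (fun b => (P.M b).initialState, none) (P.join V T) = P.conf l V T := rfl

theorem step_conf (l : Label P.n) :
    TM2.step P.program (P.conf (.inr l) V T) =
      some (TM2.stepAux (P.body l) (fun b => (P.M b).initialState, none) (P.join V T)) := rfl

end steps

/-! ### The loops of the calling machine -/

section loops

variable (V : ∀ b k, List ((P.M b).Γ k)) (io R tm : List Bool) (lo cnt : Bool → List Bool)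

theorem within_unload :
    Within (TM2.step P.program) (io.length + 1) (P.conf (.inr .unload) V ⟨io, R, tm, lo, cnt⟩)
      (P.conf (.inr .load) V ⟨[], R, io.reverse ++ tm, lo, cnt⟩) := by
  induction io generalizing tm with
  | nil =>
    refine Within.single ?_
    simp only [step_conf, body, stepAux_popCase_io]
    rfl
  | cons c l ih =>
    refine Within.head (b := P.conf (.inr .unload) V ⟨l, R, c :: tm, lo, cnt⟩) ?_ ?_
    · simp only [step_conf, body, stepAux_popCase_io, List.head?_cons, stepAux_put_tmp, stepAux_jump,
        List.tail_cons]
    · simpa using ih (c :: tm)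

theorem within_load (x : List Bool) :
    Within (TM2.step P.program) (tm.length + 1)
      (P.conf (.inr .load) (P.inputs x) ⟨io, R, tm, lo, cnt⟩)
      (P.conf (.inl ⟨false, (P.M false).main⟩) (P.inputs (tm.reverse ++ x))
        ⟨io, true :: R, [], lo, cnt⟩) := by
  induction tm generalizing x with
  | nil =>
    refine Within.single ?_
    simp only [step_conf, body, stepAux_popCase_tmp, List.head?_nil, stepAux_put_rev, stepAux_jump]
    rfl
  | cons c l ih =>
    refine Within.head (b := P.conf (.inr .load) (P.inputs (c :: x)) ⟨io, R, l, lo, cnt⟩) ?_ ?_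
    · simp only [step_conf, body, stepAux_popCase_tmp, List.head?_cons, List.tail_cons]
      -- The intermediate stacks, when the symbol has been pushed for the first machine but not yet
      -- for the second.
      have h₁ : ∀ T, update (P.join (P.inputs x) T) (.inl ⟨false, (P.M false).k₀⟩ : P.K)
          ((P.enc false).symm c :: P.inputs x false (P.M false).k₀) =
          P.join (fun b => cond b (P.inputs x b) (P.inputs (c :: x) b)) T := by
        intro T
        refine (P.update_join_inl _ T _ _ _).trans (congrArg (fun V => P.join V T) ?_)
        refine update_eq_iff.2 ⟨?_, ?_⟩
        · simp [inputs]
        · rintro (_ | _) hb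
          · exact absurd rfl hb
          · rfl
      have h₂ : ∀ T, update (P.join (fun b => cond b (P.inputs x b) (P.inputs (c :: x) b)) T)
          (.inl ⟨true, (P.M true).k₀⟩ : P.K)
          ((P.enc true).symm c :: P.inputs x true (P.M true).k₀) =
          P.join (P.inputs (c :: x)) T := by
        intro T
        refine (P.update_join_inl _ T _ _ _).trans (congrArg (fun V => P.join V T) ?_)
        refine update_eq_iff.2 ⟨?_, ?_⟩
        · simp [inputs]
        · rintro (_ | _) hb
          · rfl
          · exact absurd rfl hb
      rw [← stepAux_jump, ← h₂, ← h₁]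
      rfl
    · simpa using ih (c :: x)

theorem within_first (b : Bool) (U : Bool → List Bool) :
    Within (TM2.step P.program) (ones (U b) + 1)
      (P.conf (.inr (.first b)) (P.outputs U) ⟨io, R, tm, lo, cnt⟩)
      (match b with
        | false => P.conf (.inr (.first true)) (P.outputs (update U false (skip (U false))))
            ⟨io, List.replicate (ones (U false)) true ++ R, tm,
              update lo false (List.replicate (ones (U false)) true ++ lo false),
              update cnt true (List.replicate (ones (U false)) true ++ cnt true)⟩
        | true => TM2.stepAux (P.enter P.n le_rfl) (fun b => (P.M b).initialState, none)
            (P.join (P.outputs (update U true (skip (U true))))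
              ⟨io, false :: (List.replicate (ones (U true)) true ++ R), tm,
                update lo true (List.replicate (ones (U true)) true ++ lo true),
                update cnt false (List.replicate (ones (U true)) true ++ cnt false)⟩)) := by
  generalize hu : U b = u
  induction u generalizing U R lo cnt with
  | nil =>
    refine Within.single ?_
    cases b <;> simp only [step_conf, body, stepAux_popCase_out, hu, List.head?_nil] <;>
      simp [stepAux_jump, stepAux_put_rev, ones, skip]
  | cons c l ih =>
    cases c with
    | false =>
      refine Within.single ?_
      cases b <;> simp only [step_conf, body, stepAux_popCase_out, hu, List.head?_cons] <;>
        simp [stepAux_jump, stepAux_put_rev, ones, skip]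
    | true =>
      refine Within.head (b := P.conf (.inr (.first b)) (P.outputs (update U b l))
        ⟨io, true :: R, tm, update lo b (true :: lo b), update cnt (!b) (true :: cnt (!b))⟩) ?_ ?_
      · simp only [step_conf, body, stepAux_popCase_out, hu, List.head?_cons, stepAux_put_rev,
          stepAux_put_lo, stepAux_put_cnt, stepAux_jump, List.tail_cons]
      · have h := ih (true :: R) (update lo b (true :: lo b))
          (update cnt (!b) (true :: cnt (!b))) (update U b l) (by simp)
        cases b <;> simpa [ones, skip, hu, replicate_append_cons, List.replicate_succ] using h

theorem within_blocks (i : Fin P.n) (b : Bool) (U : Bool → List Bool) :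
    Within (TM2.step P.program) (ones (U b) + 1)
      (P.conf (.inr (.blocks i b)) (P.outputs U) ⟨io, R, tm, lo, cnt⟩)
      (match b with
        | false => P.conf (.inr (.blocks i true)) (P.outputs (update U false (skip (U false))))
            ⟨io, List.replicate (ones (U false)) true ++ R, tm, lo, cnt⟩
        | true => TM2.stepAux (P.enter i i.2.le) (fun b => (P.M b).initialState, none)
            (P.join (P.outputs (update U true (skip (U true))))
              ⟨io, false :: (List.replicate (ones (U true)) true ++ R), tm, lo, cnt⟩)) := by
  generalize hu : U b = u
  induction u generalizing U R with
  | nil =>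
    refine Within.single ?_
    cases b <;> simp only [step_conf, body, stepAux_popCase_out, hu, List.head?_nil] <;>
      simp [stepAux_jump, stepAux_put_rev, ones, skip]
  | cons c l ih =>
    cases c with
    | false =>
      refine Within.single ?_
      cases b <;> simp only [step_conf, body, stepAux_popCase_out, hu, List.head?_cons] <;>
        simp [stepAux_jump, stepAux_put_rev, ones, skip]
    | true =>
      refine Within.head (b := P.conf (.inr (.blocks i b)) (P.outputs (update U b l))
        ⟨io, true :: R, tm, lo, cnt⟩) ?_ ?_
      · simp only [step_conf, body, stepAux_popCase_out, hu, List.head?_cons, stepAux_put_rev,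
          stepAux_jump, List.tail_cons]
      · have h := ih (true :: R) (update U b l) (by simp)
        cases b <;> simpa [ones, skip, hu, replicate_append_cons, List.replicate_succ] using h

theorem within_pinCopy (b : Bool) (a : ℕ) (h : lo b = List.replicate a true) :
    Within (TM2.step P.program) (a + 1)
      (P.conf (.inr (.pinCopy b)) V ⟨io, R, tm, lo, cnt⟩)
      (P.conf (.inr (.pinRestore b)) V ⟨io, false :: (List.replicate a true ++ R),
        List.replicate (a + 1) true ++ tm, update lo b [], cnt⟩) := by
  induction a generalizing R tm lo with
  | zero =>
    refine Within.single ?_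
    simp only [step_conf, body, stepAux_popCase_lo, h, List.replicate_zero, List.head?_nil,
      stepAux_put_rev, stepAux_put_tmp, stepAux_jump]
    rfl
  | succ a ih =>
    refine Within.head (b := P.conf (.inr (.pinCopy b)) V
      ⟨io, true :: R, true :: tm, update lo b (List.replicate a true), cnt⟩) ?_ ?_
    · simp only [step_conf, body, stepAux_popCase_lo, h, List.replicate_succ, List.head?_cons,
        stepAux_put_rev, stepAux_put_tmp, stepAux_jump, List.tail_cons]
    · have h' := ih (true :: R) (true :: tm) (update lo b (List.replicate a true)) (by simp)
      simpa [replicate_append_cons, List.replicate_succ] using h'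

theorem within_pinRestore (b : Bool) (a : ℕ) :
    Within (TM2.step P.program) (a + 1)
      (P.conf (.inr (.pinRestore b)) V ⟨io, R, List.replicate a true, lo, cnt⟩)
      (P.conf (.inr (.pin b)) V
        ⟨io, R, [], update lo b (List.replicate a true ++ lo b), cnt⟩) := by
  induction a generalizing lo with
  | zero =>
    refine Within.single ?_
    simp only [step_conf, body, stepAux_popCase_tmp, List.replicate_zero, List.head?_nil,
      stepAux_jump, List.nil_append, update_eq_self]
    rfl
  | succ a ih =>
    refine Within.head (b := P.conf (.inr (.pinRestore b)) V
      ⟨io, R, List.replicate a true, update lo b (true :: lo b), cnt⟩) ?_ ?_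
    · simp only [step_conf, body, stepAux_popCase_tmp, List.replicate_succ, List.head?_cons,
        stepAux_put_lo, stepAux_jump, List.tail_cons]
    · have h' := ih (update lo b (true :: lo b))
      simpa [replicate_append_cons, List.replicate_succ] using h'

/-- A round takes `2 * a + 4` steps, to copy and restore the counter, and increases `a` by one. The
counter never exceeds `a + c`, hence the quadratic bound. -/
theorem within_pin (b : Bool) (a c : ℕ) (ha : lo b = List.replicate a true)
    (hc : cnt b = List.replicate c true) :
    Within (TM2.step P.program) (c * (2 * (a + c) + 4) + 1)
      (P.conf (.inr (.pin b)) V ⟨io, R, [], lo, cnt⟩)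
      (P.conf (.inr (.shift b .tag)) V
        ⟨io, (P.t.mid b).reverse ++ ((pinsCode a c).reverse ++ R), [],
          update lo b (List.replicate (a + c) true), update cnt b []⟩) := by
  induction c generalizing a R lo cnt with
  | zero =>
    refine (Within.single ?_).mono (Nat.le_add_left _ _)
    simp only [step_conf, body, stepAux_popCase_cnt, hc, List.replicate_zero, List.head?_nil,
      stepAux_write, stepAux_jump]
    simp [pinsCode, ← ha]
  | succ c ih =>
    have h₁ : Within (TM2.step P.program) 1 (P.conf (.inr (.pin b)) V ⟨io, R, [], lo, cnt⟩)
        (P.conf (.inr (.pinCopy b)) V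
          ⟨io, [true, false, false, true, false, false, false, true].reverse ++ R, [], lo,
            update cnt b (List.replicate c true)⟩) := by
      refine Within.single ?_
      simp only [step_conf, body, stepAux_popCase_cnt, hc, List.replicate_succ, List.head?_cons,
        stepAux_write, stepAux_jump, List.tail_cons]
    have h₂ := P.within_pinCopy V io
      ([true, false, false, true, false, false, false, true].reverse ++ R) [] lo
      (update cnt b (List.replicate c true)) b a ha
    rw [List.append_nil] at h₂
    have h₃ := P.within_pinRestore V io (false :: (List.replicate a true ++
      ([true, false, false, true, false, false, false, true].reverse ++ R))) (update lo b [])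
      (update cnt b (List.replicate c true)) b (a + 1)
    have h₄ := ih (false :: (List.replicate a true ++
      ([true, false, false, true, false, false, false, true].reverse ++ R)))
      (update lo b (List.replicate (a + 1) true)) (update cnt b (List.replicate c true)) (a + 1)
      (by simp) (by simp)
    rw [update_idem, update_self, List.append_nil] at h₃
    have h := ((h₁.trans h₂).trans h₃).trans h₄
    have e : (P.t.mid b).reverse ++ ((pinsCode a (c + 1)).reverse ++ R) =
        (P.t.mid b).reverse ++ ((pinsCode (a + 1) c).reverse ++ (false :: (List.replicate a true ++
      ([true, false, false, true, false, false, false, true].reverse ++ R)))) := by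
      simp [pinsCode, bitCode, unary, List.replicate_succ]
    rw [e]
    rw [update_idem, update_idem, show a + 1 + c = a + (c + 1) by omega] at h
    refine h.mono ?_
    nlinarith

theorem within_shift (b : Bool) (q : Mode) (U : Bool → List Bool) :
    Within (TM2.step P.program) ((U b).length + 1)
      (P.conf (.inr (.shift b q)) (P.outputs U) ⟨io, R, tm, lo, cnt⟩)
      (P.conf (.inr (.clear b)) (P.outputs (update U b []))
        ⟨io, (q.run (U b)).reverse ++ R, tm, lo, cnt⟩) := by
  generalize hu : U b = u
  induction u generalizing U R q with
  | nil =>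
    refine Within.single ?_
    simp only [step_conf, body, stepAux_popCase_out, hu, List.head?_nil, stepAux_jump, Mode.run,
      List.tail_nil, List.reverse_nil, List.nil_append]
  | cons c l ih =>
    refine Within.head (b := P.conf (.inr (.shift b (q.next c))) (P.outputs (update U b l))
      ⟨io, (q.emit c).reverse ++ R, tm, lo, cnt⟩) ?_ ?_
    · simp only [step_conf, body, stepAux_popCase_out, hu, List.head?_cons, stepAux_write,
        stepAux_jump, List.tail_cons]
    · simpa [Mode.run] using ih ((q.emit c).reverse ++ R) (q.next c) (update U b l) (by simp)

theorem within_clear (b : Bool) :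
    Within (TM2.step P.program) ((lo b).length + 1)
      (P.conf (.inr (.clear b)) V ⟨io, R, tm, lo, cnt⟩)
      (match b with
        | false => P.conf (.inr (.pin true)) V
            ⟨io, (P.t.pre true).reverse ++ R, tm, update lo false [], cnt⟩
        | true => P.conf (.inr .fin) V ⟨io, R, tm, update lo true [], cnt⟩) := by
  generalize hl : lo b = l
  induction l generalizing lo with
  | nil =>
    refine Within.single ?_
    cases b <;> simp only [step_conf, body, stepAux_popCase_lo, hl, List.head?_nil, stepAux_write,
      stepAux_jump, List.tail_nil]
  | cons c l ih =>
    refine Within.head (b := P.conf (.inr (.clear b)) V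
      ⟨io, R, tm, update lo b l, cnt⟩) ?_ ?_
    · simp only [step_conf, body, stepAux_popCase_lo, hl, List.head?_cons, stepAux_jump,
        List.tail_cons]
    · have h := ih (update lo b l) (by simp)
      cases b <;> simpa using h

theorem within_fin :
    Within (TM2.step P.program) (R.length + 1)
      (P.conf (.inr .fin) V ⟨io, R, tm, lo, cnt⟩)
      ⟨none, (fun b => (P.M b).initialState, none),
        P.join V ⟨R.reverse ++ io, [], tm, lo, cnt⟩⟩ := by
  induction R generalizing io with
  | nil =>
    refine Within.single ?_
    simp only [step_conf, body, stepAux_popCase_rev, List.head?_nil]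
    rfl
  | cons c l ih =>
    refine Within.head (b := P.conf (.inr .fin) V ⟨c :: io, l, tm, lo, cnt⟩) ?_ ?_
    · simp only [step_conf, body, stepAux_popCase_rev, List.head?_cons, stepAux_put_io, stepAux_jump,
        List.tail_cons]
    · simpa using ih (c :: io)

end loops

end Callees

namespace Callees

variable (P : Callees)

/-! ### The called machines -/

/-- The configuration in which the called machine `b` is in the configuration `c`. -/
def embed (b : Bool) (v : P.State) (V : ∀ b k, List ((P.M b).Γ k)) (T : Tapes)
    (c : TM2.Cfg (P.M b).Γ (P.M b).Λ (P.M b).σ) : P.Config :=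
  ⟨some (c.l.elim (P.after b) fun l => .inl ⟨b, l⟩), (update v.1 b c.var, v.2),
    P.join (update V b c.stk) T⟩

theorem stepAux_lift (b : Bool) (q : TM2.Stmt (P.M b).Γ (P.M b).Λ (P.M b).σ) (v : P.State)
    (V : ∀ b k, List ((P.M b).Γ k)) (T : Tapes) :
    TM2.stepAux (P.lift b (P.after b) q) v (P.join V T) =
      P.embed b v V T (TM2.stepAux q (v.1 b) (V b)) := by
  induction q generalizing v V with
  | push k g q ih =>
    refine (congrArg (TM2.stepAux _ v) (P.update_join_inl V T b k _)).trans ((ih _ _).trans ?_)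
    simp only [embed, update_self, update_idem]
    rfl
  | peek k g q ih =>
    refine (ih (update v.1 b _, v.2) V).trans ?_
    simp only [embed, update_self, update_idem]
    rfl
  | pop k g q ih =>
    refine (congrArg (TM2.stepAux _ _) (P.update_join_inl V T b k _)).trans
      ((ih (update v.1 b _, v.2) _).trans ?_)
    simp only [embed, update_self, update_idem]
    rfl
  | load g q ih =>
    refine (ih (update v.1 b _, v.2) V).trans ?_
    simp only [embed, update_self, update_idem]
    rfl
  | branch g q₁ q₂ ih₁ ih₂ =>
    simp only [lift, TM2.stepAux]
    cases g (v.1 b)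
    · exact ih₂ v V
    · exact ih₁ v V
  | goto g => simp [lift, embed]
  | halt => simp [lift, embed]

/-- The simulation is step for step. A halted configuration is embedded with the label `after b`, so
the return costs no additional step. -/
theorem within_embed (b : Bool) (v : P.State) (V : ∀ b k, List ((P.M b).Γ k)) (T : Tapes) (s : ℕ)
    {c c' : TM2.Cfg (P.M b).Γ (P.M b).Λ (P.M b).σ}
    (h : (flip bind (TM2.step (P.M b).m))^[s] (some c) = some c') :
    Within (TM2.step P.program) s (P.embed b v V T c) (P.embed b v V T c') := by
  induction s generalizing c with
  | zero =>
    obtain rfl : c = c' := by simpa using h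
    exact Within.refl
  | succ s ih =>
    rw [Function.iterate_succ_apply] at h
    obtain ⟨_ | l, x, S⟩ := c
    · have h' : (flip bind (TM2.step (P.M b).m))^[s] none = some c' := h
      rw [iterate_bind_none] at h'
      exact absurd h' (by simp)
    · have h' : (flip bind (TM2.step (P.M b).m))^[s]
          (some (TM2.stepAux ((P.M b).m l) x S)) = some c' := h
      refine Within.head (congrArg some ?_) (ih h')
      refine (P.stepAux_lift b ((P.M b).m l) (update v.1 b x, v.2) (update V b S) T).trans ?_
      simp only [embed, update_self, update_idem]

variable {P}

/-- Each machine touches only its own stacks and state, and halting restores its initial state, so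
the two runs can be put one after the other. -/
theorem within_run {x : List Bool} {U : Bool → List Bool} {τ : Bool → ℕ}
    (h : ∀ b, TM2OutputsInTime (P.M b) (x.map (P.enc b).symm) (some ((U b).map (P.dec b).symm))
      (τ b)) (T : Tapes) :
    Within (TM2.step P.program) (τ false + τ true)
      (P.conf (.inl ⟨false, (P.M false).main⟩) (P.inputs x) T)
      (P.conf (.inr (.first false)) (P.outputs U) T) := by
  have key : ∀ b V, V b = P.inputs x b →
      Within (TM2.step P.program) (τ b) (P.conf (.inl ⟨b, (P.M b).main⟩) V T)
        (P.conf (P.after b) (update V b (P.outputs U b)) T) := by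
    intro b V hV
    obtain ⟨⟨s, hs⟩, hle⟩ := h b
    rw [initList_eq, Option.map_some, haltList_eq] at hs
    have h₁ := P.within_embed b (fun b => (P.M b).initialState, none) V T s hs
    refine Within.mono ?_ hle
    have h₂ : update V b (P.inputs x b) = V := by rw [← hV, update_eq_self]
    unfold embed at h₁
    simp only [update_eq_self] at h₁
    change Within _ _ (P.conf _ (update V b (P.inputs x b)) T) _ at h₁
    rw [h₂] at h₁
    exact h₁
  have h₁ := (key false (P.inputs x) rfl).trans
    (key true (update (P.inputs x) false (P.outputs U false)) (by simp))
  have h₂ : update (update (P.inputs x) false (P.outputs U false)) true (P.outputs U true) =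
      P.outputs U := by
    funext b
    cases b <;> simp
  rwa [h₂] at h₁

end Callees

theorem ones_add_length_skip_le (u : List Bool) : ones u + (skip u).length ≤ u.length := by
  induction u with
  | nil => simp [ones, skip]
  | cons c u ih => cases c <;> simp [ones, skip]; omega

theorem length_iterate_skip_le (k : ℕ) (u : List Bool) : (skip^[k] u).length ≤ u.length := by
  induction k generalizing u with
  | zero => simp
  | succ k ih =>
    rw [Function.iterate_succ_apply]
    have := ones_add_length_skip_le u
    exact (ih _).trans (by omega)

namespace Callees

variable (P : Callees)

/-! ### The whole computation -/

theorem within_enter (i : ℕ) (hi : i ≤ P.n) (U : Bool → List Bool) (io R tm : List Bool)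
    (lo cnt : Bool → List Bool) :
    Within (TM2.step P.program) ((U false).length + (U true).length + 2 * i)
      (TM2.stepAux (P.enter i hi) (fun b => (P.M b).initialState, none)
        (P.join (P.outputs U) ⟨io, R, tm, lo, cnt⟩))
      (P.conf (.inr (.pin false)) (P.outputs fun b => skip^[i] (U b))
        ⟨io, (P.t.pre false).reverse ++ ((addHeaders i (U false) (U true)).reverse ++ R),
          tm, lo, cnt⟩) := by
  induction i generalizing U R with
  | zero =>
    refine Within.mono ?_ (Nat.zero_le _)
    rw [enter, stepAux_write, stepAux_jump]
    exact Within.refl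
  | succ i ih =>
    rw [enter, stepAux_jump]
    have h₁ := P.within_blocks io R tm lo cnt ⟨i, hi⟩ false U
    have h₂ := P.within_blocks io (List.replicate (ones (U false)) true ++ R) tm lo cnt ⟨i, hi⟩ true
      (update U false (skip (U false)))
    have hU : update (update U false (skip (U false))) true (skip (U true)) =
        fun b => skip (U b) := by
      funext b
      cases b <;> simp
    have hU' : update U false (skip (U false)) true = U true := by simp
    simp only [hU', hU] at h₂
    have h₃ := ih (Nat.le_of_succ_le hi) (fun b => skip (U b))
      (false :: (List.replicate (ones (U true)) true ++
        (List.replicate (ones (U false)) true ++ R)))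
    have e : (addHeaders (i + 1) (U false) (U true)).reverse ++ R =
        (addHeaders i (skip (U false)) (skip (U true))).reverse ++
          (false :: (List.replicate (ones (U true)) true ++
            (List.replicate (ones (U false)) true ++ R))) := by
      simp only [addHeaders, unary, List.replicate_add]
      -- The two runs of ones are kept apart, as the loops wrote them.
      simp [-List.replicate_append_replicate]
    rw [e]
    refine ((h₁.trans h₂).trans h₃).mono ?_
    have l₁ := ones_add_length_skip_le (U false)
    have l₂ := ones_add_length_skip_le (U true)
    omega

/-- A bound for the time that the machine needs to merge two strings of total length `L`. -/
def mergeTime (L : ℕ) : ℕ := 2 * L ^ 2 + 9 * L + (2 * P.n + 8)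

/-- Each loop puts its segment of `Template.apply` on the reversed output, and in the end the
counters and both inputs of the merge have been used up. -/
theorem within_merge (U : Bool → List Bool) :
    Within (TM2.step P.program) (P.mergeTime ((U false).length + (U true).length))
      (P.conf (.inr (.first false)) (P.outputs U) ⟨[], [true], [], fun _ => [], fun _ => []⟩)
      (P.conf (.inr .fin) (P.outputs fun _ => [])
        ⟨[], (P.t.apply (P.n + 1) (U false) (U true)).reverse, [], fun _ => [], fun _ => []⟩) := by
  obtain ⟨u, hu⟩ : ∃ u, U false = u := ⟨_, rfl⟩
  obtain ⟨w, hw⟩ : ∃ w, U true = w := ⟨_, rfl⟩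
  rw [hu, hw]
  have h₁ := P.within_first [] [true] [] (fun _ => []) (fun _ => []) false U
  have h₂ := P.within_first [] (List.replicate (ones u) true ++ [true]) []
    (update (fun _ => []) false (List.replicate (ones u) true))
    (update (fun _ => []) true (List.replicate (ones u) true)) true (update U false (skip u))
  have hU : update (update U false (skip u)) true (skip w) = fun b => skip (U b) := by
    funext b
    cases b <;> simp [hu, hw]
  have hU' : update U false (skip u) true = w := by simp [hw]
  have hlo : update (update (fun _ => []) false (List.replicate (ones u) true)) true
      (List.replicate (ones w) true) = fun b => List.replicate (cond b (ones w) (ones u)) true := by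
    funext b
    cases b <;> simp
  have hcnt : update (update (fun _ => []) true (List.replicate (ones u) true)) false
      (List.replicate (ones w) true) = fun b => List.replicate (cond b (ones u) (ones w)) true := by
    funext b
    cases b <;> simp
  simp only [hu, List.append_nil] at h₁
  simp only [hU', hU, ne_eq, Bool.true_eq_false, Bool.false_eq_true, not_false_eq_true,
    update_of_ne, List.append_nil, hlo, hcnt] at h₂
  have h₃ := P.within_enter P.n le_rfl (fun b => skip (U b)) []
    (false :: (List.replicate (ones w) true ++ (List.replicate (ones u) true ++ [true]))) []
    (fun b => List.replicate (cond b (ones w) (ones u)) true)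
    (fun b => List.replicate (cond b (ones u) (ones w)) true)
  simp only [← Function.iterate_succ_apply skip, hu, hw] at h₃
  set R₃ := (P.t.pre false).reverse ++ ((addHeaders P.n (skip u) (skip w)).reverse ++
    (false :: (List.replicate (ones w) true ++ (List.replicate (ones u) true ++ [true]))))
    with hR₃
  have h₄ := P.within_pin (P.outputs fun b => skip^[P.n + 1] (U b)) [] R₃
    (fun b => List.replicate (cond b (ones w) (ones u)) true)
    (fun b => List.replicate (cond b (ones u) (ones w)) true) false (ones u) (ones w) rfl rfl
  set R₄ := (P.t.mid false).reverse ++ ((pinsCode (ones u) (ones w)).reverse ++ R₃) with hR₄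
  have h₅ := P.within_shift [] R₄ [] (update (fun b => List.replicate (cond b (ones w) (ones u)) true)
      false (List.replicate (ones u + ones w) true))
    (update (fun b => List.replicate (cond b (ones u) (ones w)) true) false []) false .tag
    (fun b => skip^[P.n + 1] (U b))
  set R₅ := (Mode.tag.run (skip^[P.n + 1] (U false))).reverse ++ R₄ with hR₅
  have h₆ := P.within_clear (P.outputs (update (fun b => skip^[P.n + 1] (U b)) false [])) [] R₅ []
    (update (fun b => List.replicate (cond b (ones w) (ones u)) true)
      false (List.replicate (ones u + ones w) true))
    (update (fun b => List.replicate (cond b (ones u) (ones w)) true) false []) false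
  simp only [update_idem, update_self, List.length_replicate] at h₆
  set R₆ := (P.t.pre true).reverse ++ R₅ with hR₆
  have h₇ := P.within_pin (P.outputs (update (fun b => skip^[P.n + 1] (U b)) false [])) [] R₆
    (update (fun b => List.replicate (cond b (ones w) (ones u)) true) false [])
    (update (fun b => List.replicate (cond b (ones u) (ones w)) true) false [])
    true (ones w) (ones u) (by simp) (by simp)
  set R₇ := (P.t.mid true).reverse ++ ((pinsCode (ones w) (ones u)).reverse ++ R₆) with hR₇
  have h₈ := P.within_shift [] R₇ []
    (update (update (fun b => List.replicate (cond b (ones w) (ones u)) true) false []) true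
      (List.replicate (ones w + ones u) true))
    (update (update (fun b => List.replicate (cond b (ones u) (ones w)) true) false []) true [])
    true .tag (update (fun b => skip^[P.n + 1] (U b)) false [])
  have hV : update (update (fun b => skip^[P.n + 1] (U b)) false []) true [] = fun _ => [] := by
    funext b
    cases b <;> simp
  have hV' : update (fun b => skip^[P.n + 1] (U b)) false [] true = skip^[P.n + 1] w := by
    simp [hw]
  rw [hV, hV'] at h₈
  set R₈ := (Mode.tag.run (skip^[P.n + 1] w)).reverse ++ R₇ with hR₈
  have h₉ := P.within_clear (P.outputs fun _ => []) [] R₈ []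
    (update (update (fun b => List.replicate (cond b (ones w) (ones u)) true) false []) true
      (List.replicate (ones w + ones u) true))
    (update (update (fun b => List.replicate (cond b (ones u) (ones w)) true) false []) true [])
    true
  have hlo' : update (update (fun b => List.replicate (cond b (ones w) (ones u)) true) false [])
      true [] = fun _ => [] := by
    funext b
    cases b <;> simp
  have hcnt' : update (update (fun b => List.replicate (cond b (ones u) (ones w)) true) false [])
      true [] = fun _ => [] := by
    funext b
    cases b <;> simp
  simp only [update_idem, update_self, List.length_replicate, hlo', hcnt'] at h₉
  have e : R₈ = (P.t.apply (P.n + 1) u w).reverse := by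
    simp only [hR₈, hR₇, hR₆, hR₅, hR₄, hR₃, Template.apply, addHeaders, unary,
      List.replicate_add, hu]
    simp [-List.replicate_append_replicate]
  rw [e] at h₈ h₉
  rw [hcnt'] at h₇ h₈
  refine ((((((((h₁.trans h₂).trans h₃).trans h₄).trans h₅).trans h₆).trans h₇).trans h₈).trans
    h₉).mono ?_
  have l₁ := ones_add_length_skip_le u
  have l₂ := ones_add_length_skip_le w
  have l₃ := length_iterate_skip_le (P.n + 1) u
  have l₄ := length_iterate_skip_le (P.n + 1) w
  -- The two pinning loops together; all other loops are linear.
  have l₅ : (ones u + ones w) * (2 * (ones u + ones w) + 4) ≤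
      (u.length + w.length) * (2 * (u.length + w.length) + 4) :=
    Nat.mul_le_mul (by omega) (by omega)
  rw [hu]
  simp only [mergeTime]
  nlinarith

variable {P}

theorem within_machine {x : List Bool} {U : Bool → List Bool} {τ : Bool → ℕ}
    (h : ∀ b, TM2OutputsInTime (P.M b) (x.map (P.enc b).symm) (some ((U b).map (P.dec b).symm))
      (τ b)) :
    Within (TM2.step P.program)
      (2 * x.length + 2 + (τ false + τ true) + P.mergeTime ((U false).length + (U true).length))
      (P.conf (.inr .unload) (fun _ _ => []) ⟨x, [], [], fun _ => [], fun _ => []⟩)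
      (P.conf (.inr .fin) (fun _ _ => [])
        ⟨[], (P.t.apply (P.n + 1) (U false) (U true)).reverse, [], fun _ => [], fun _ => []⟩) := by
  have hin : P.inputs [] = fun _ _ => [] := by
    funext b k
    simp [inputs]
  have hout : P.outputs (fun _ => []) = fun _ _ => [] := by
    funext b k
    simp [outputs]
  have h₁ := P.within_unload (fun _ _ => []) x [] [] (fun _ => []) (fun _ => [])
  have h₂ := P.within_load [] [] x.reverse (fun _ => []) (fun _ => []) []
  rw [List.append_nil] at h₁
  rw [hin, List.append_nil, List.reverse_reverse, List.length_reverse] at h₂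
  have h₃ := within_run h ⟨[], [true], [], fun _ => [], fun _ => []⟩
  have h₄ := P.within_merge U
  rw [hout] at h₄
  refine (((h₁.trans h₂).trans h₃).trans h₄).mono (le_of_eq ?_)
  ring

end Callees

/-! ### Polynomial time of the merged computation -/

theorem exists_pushCount_le (tm : FinTM2) : ∃ C, ∀ l, pushCount (tm.m l) ≤ C := by
  have := tm.ΛFin
  exact ⟨Finset.univ.sup fun l => pushCount (tm.m l),
    fun l => Finset.le_sup (f := fun l => pushCount (tm.m l)) (Finset.mem_univ l)⟩

theorem length_output_le {tm : FinTM2} {C : ℕ} (hC : ∀ l, pushCount (tm.m l) ≤ C)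
    {s : List (tm.Γ tm.k₀)} {s' : List (tm.Γ tm.k₁)} {τ : ℕ}
    (h : TM2OutputsInTime tm s (some s') τ) : s'.length ≤ s.length + C * τ := by
  obtain ⟨⟨r, hr⟩, hle⟩ := h
  rw [initList_eq, Option.map_some, haltList_eq] at hr
  have h₁ := length_iterate_le hC tm.k₁ r hr
  simp only [update_self] at h₁
  -- The input and output stacks may coincide; otherwise the output stack is initially empty.
  have h₂ : (update (fun k => ([] : List (tm.Γ k))) tm.k₀ s tm.k₁).length ≤ s.length := by
    clear hr h₁
    generalize tm.k₁ = k
    by_cases hk : k = tm.k₀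
    · subst hk
      rw [update_self]
    · rw [update_of_ne hk]
      exact Nat.zero_le _
  have h₃ : C * r ≤ C * τ := Nat.mul_le_mul_left C hle
  omega

/-- The called machines run in polynomial time, so their outputs have polynomial length, and merging
is quadratic in that length. -/
theorem polyTimeComputable_applyStr (t : Template) (n : ℕ) {μ₁ μ₂ : Str → Str}
    (h₁ : PolyTimeComputable μ₁) (h₂ : PolyTimeComputable μ₂) :
    PolyTimeComputable fun x => t.applyStr (n + 1) (μ₁ x) (μ₂ x) := by
  obtain ⟨m₁⟩ := h₁
  obtain ⟨m₂⟩ := h₂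
  let P : Callees :=
    { M := fun b => match b with
        | false => m₁.tm
        | true => m₂.tm
      enc := fun b => match b with
        | false => m₁.inputAlphabet
        | true => m₂.inputAlphabet
      dec := fun b => match b with
        | false => m₁.outputAlphabet
        | true => m₂.outputAlphabet
      t := t
      n := n }
  obtain ⟨C₁, hC₁⟩ := exists_pushCount_le m₁.tm
  obtain ⟨C₂, hC₂⟩ := exists_pushCount_le m₂.tm
  obtain ⟨D, hD⟩ := exists_pushCount_le P.machine
  -- A bound for the total length of the two outputs: each is at most the input length plus a
  -- constant times the running time.
  let L : Polynomial ℕ := 2 * Polynomial.X + (C₁ : Polynomial ℕ) * m₁.time +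
    (C₂ : Polynomial ℕ) * m₂.time
  let T : Polynomial ℕ := 2 * Polynomial.X + 2 + (m₁.time + m₂.time) +
    (2 * L ^ 2 + 9 * L + ((2 * n + 8 : ℕ) : Polynomial ℕ))
  -- `y` and `z` are kept free because the structure built at the end presents them as images under
  -- the identity of the alphabet.
  have key : ∀ (x : Str) (y z : List Bool), y = x.1 → z = (t.applyStr (n + 1) (μ₁ x) (μ₂ x)).1 →
      Nonempty (TM2OutputsInTime P.machine y (some z)
        ((T + ((D : Polynomial ℕ) * T + 1)).eval x.1.length)) := by
    rintro x _ _ rfl rfl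
    let U : Bool → List Bool := fun b => cond b (μ₂ x).1 (μ₁ x).1
    let τ : Bool → ℕ := fun b => cond b (m₂.time.eval x.1.length) (m₁.time.eval x.1.length)
    have hM : ∀ b, Nonempty (TM2OutputsInTime (P.M b) (x.1.map (P.enc b).symm)
        (some ((U b).map (P.dec b).symm)) (τ b)) := by
      rintro (_ | _)
      · exact ⟨m₁.outputsFun x⟩
      · exact ⟨m₂.outputsFun x⟩
    have l₁ := length_output_le hC₁ (m₁.outputsFun x)
    have l₂ := length_output_le hC₂ (m₂.outputsFun x)
    rw [List.length_map, List.length_map] at l₁ l₂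
    have hL : (U false).length + (U true).length ≤ L.eval x.1.length := by
      simp only [L, Polynomial.eval_add, Polynomial.eval_mul, Polynomial.eval_natCast, Nat.cast_id,
        Polynomial.eval_X, Polynomial.eval_ofNat]
      change (μ₁ x).1.length + (μ₂ x).1.length ≤ _
      omega
    have w₁ : Within (TM2.step P.program) (T.eval x.1.length) _ _ :=
      (Callees.within_machine fun b => (hM b).some).mono (by
        simp only [T, Polynomial.eval_add, Polynomial.eval_mul, Polynomial.eval_natCast, Nat.cast_id,
          Polynomial.eval_X, Polynomial.eval_ofNat, Polynomial.eval_pow, Callees.mergeTime]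
        have := Nat.pow_le_pow_left hL 2
        change _ + _ + (m₁.time.eval x.1.length + m₂.time.eval x.1.length) + _ ≤ _
        change _ + (2 * _ + 9 * _ + (2 * n + 8)) ≤ _
        omega)
    have w₂ := P.within_fin (fun _ _ => []) [] (t.apply (n + 1) (μ₁ x).1 (μ₂ x).1).reverse []
      (fun _ => []) (fun _ => [])
    -- The final copy takes one step per symbol. The stack starts empty and grows by at most `D` per
    -- step, so its height is bounded by the time elapsed.
    have l₃ : (t.apply (n + 1) (μ₁ x).1 (μ₂ x).1).reverse.length ≤ D * T.eval x.1.length := by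
      obtain ⟨s, hs, h⟩ := w₁
      have := length_iterate_le hD (.inr .rev : P.K) s h
      refine this.trans ?_
      change 0 + D * s ≤ _
      rw [Nat.zero_add]
      exact Nat.mul_le_mul_left D hs
    have w := (w₁.trans w₂).mono (t := (T + ((D : Polynomial ℕ) * T + 1)).eval x.1.length) (by
      simp only [Polynomial.eval_add, Polynomial.eval_mul, Polynomial.eval_natCast, Nat.cast_id,
        Polynomial.eval_one]
      omega)
    obtain ⟨s, hs, h⟩ := w
    rw [List.reverse_reverse, List.append_nil] at h
    refine ⟨⟨⟨s, ?_⟩, hs⟩⟩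
    have hc : ∀ y : List Bool,
        update (fun k => ([] : List (P.Γ k))) (.inr .io : P.K) y =
          P.join (fun _ _ => []) ⟨y, [], [], fun _ => [], fun _ => []⟩ := by
      intro y
      have h₀ : (fun k => ([] : List (P.Γ k))) = P.join (fun _ _ => []) ⟨[], [], [], fun _ => [], fun _ => []⟩ := by
        funext k
        rcases k with p | o
        · rfl
        · cases o <;> rfl
      rw [h₀]
      exact P.update_join_io _ _ y
    exact (congrArg (fun c => (flip bind P.machine.step)^[s] (some c))
      ((initList_eq P.machine x.1).trans (congrArg (TM2.Cfg.mk _ _) (hc x.1)))).trans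
      (h.trans (congrArg some ((haltList_eq P.machine _).trans
        (congrArg (TM2.Cfg.mk _ _) (hc _))).symm))
  exact ⟨{ tm := P.machine
           inputAlphabet := Equiv.refl Bool
           outputAlphabet := Equiv.refl Bool
           time := T + ((D : Polynomial ℕ) * T + 1)
           outputsFun := fun x =>
             (key x _ _ (List.map_id x.1) (List.map_id _)).some }⟩

/-! ### The strong reductions -/

/-- If one of the two strings is not a code, every answer is valid for `ψ`. So the machine need not
recognise codes, and its output on other strings is irrelevant. -/
theorem StrongReduces.uval_of_usat_of_coUsat {ψ : PromiseProblem} {n : ℕ}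
    (h₁ : StrongReduces ψ (USAT (n + 1))) (h₂ : StrongReduces ψ (CoUSAT (n + 1))) :
    StrongReduces ψ (UVAL (n + 1)) := by
  obtain ⟨μ₁, hμ₁, h₁⟩ := h₁
  obtain ⟨μ₂, hμ₂, h₂⟩ := h₂
  refine ⟨_, polyTimeComputable_applyStr combineTemplate n hμ₁ hμ₂, fun x => ?_⟩
  specialize h₁ x
  specialize h₂ x
  by_cases c₁ : ∃ F : Input n, F.code = μ₁ x
  swap
  · rw [USAT, onCodes_of_not_code _ c₁] at h₁
    exact (Set.subset_univ _).trans h₁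
  by_cases c₂ : ∃ G : Input n, G.code = μ₂ x
  swap
  · rw [CoUSAT, onCodes_of_not_code _ c₂] at h₂
    exact (Set.subset_univ _).trans h₂
  obtain ⟨F, hF⟩ := c₁
  obtain ⟨G, hG⟩ := c₂
  rw [← hF, USAT, onCodes_code] at h₁
  rw [← hG, CoUSAT, onCodes_code] at h₂
  have e : combineTemplate.applyStr (n + 1) (μ₁ x) (μ₂ x) = (F.combine G).code := by
    rw [← hF, ← hG]
    exact Subtype.ext (F.combine_code G).symm
  rw [e, UVAL, onCodes_code]
  exact F.uval_combine_subset G h₁ h₂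

/-- A string reduction that is correct on the codes of inputs reduces everything that is
reducible to `UVAL`. -/
theorem StrongReduces.of_uval {ψ : PromiseProblem} {n : ℕ} (t : Template)
    {A : Input n → Answer} (sel : Input n → Input n → Input n)
    (hcode : ∀ F G, (sel F G).code.1 = t.apply (n + 1) F.code.1 G.code.1)
    (hsel : ∀ F G, (A (sel F G)).1 ⊆ F.uval.1) (h : StrongReduces ψ (UVAL (n + 1))) :
    StrongReduces ψ (onCodes A) := by
  obtain ⟨μ, hμ, h⟩ := h
  refine ⟨_, polyTimeComputable_applyStr t n hμ hμ, fun x => ?_⟩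
  specialize h x
  by_cases c : ∃ F : Input n, F.code = μ x
  swap
  · rw [UVAL, onCodes_of_not_code _ c] at h
    exact (Set.subset_univ _).trans h
  obtain ⟨F, hF⟩ := c
  rw [← hF, UVAL, onCodes_code] at h
  -- The second input is a dummy, so the first is used again.
  have e : t.applyStr (n + 1) (μ x) (μ x) = (sel F F).code := by
    rw [← hF]
    exact Subtype.ext (hcode F F).symm
  rw [e, onCodes_code]
  exact (hsel F F).trans h

end PromiseHierarchy

theorem theorem10 (n : ℕ) (hn : 1 ≤ n) :
    PromiseHierarchy.strongClosure (PromiseHierarchy.UVAL n) =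
      PromiseHierarchy.strongClosure (PromiseHierarchy.USAT n) ∩
        PromiseHierarchy.strongClosure (PromiseHierarchy.CoUSAT n) := by
  obtain ⟨n, rfl⟩ := Nat.exists_eq_add_of_le' hn
  ext ψ
  constructor
  · intro h
    exact ⟨h.of_uval PromiseHierarchy.selectOneTemplate PromiseHierarchy.Input.selectOne
        PromiseHierarchy.Input.selectOne_code PromiseHierarchy.Input.usat_selectOne_subset,
      h.of_uval PromiseHierarchy.selectZeroTemplate PromiseHierarchy.Input.selectZero
        PromiseHierarchy.Input.selectZero_code PromiseHierarchy.Input.coUsat_selectZero_subset⟩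
  · rintro ⟨h₁, h₂⟩
    exact h₁.uval_of_usat_of_coUsat h₂
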